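/- **Conventions.** Tensors are covariant tensors on $\mathbb{R}^3$ given by components in an orthonormal frame, $\mathcal{C}$ is the (orthogonal) projector onto the symmetric trace free part, and $A\odot B=\mathcal{C}(A\otimes B)$. Potentials are normalized so that the mass monopole is $\nu^M=m=1$, and the angular momentum monopole is $\nu^S=0$. **Abstract null data** are two sequences $\hat{\mathcal D}^\phi_n=\{\psi_{a_p\dots a_1}\}_{p\ge1}$, $\hat{\mathcal D}^S_n=\{\Psi_{a_p\dots a_1}\}_{p\ge2}$ of real symmetric trace free tensors (no estimates imposed). **Abstract multipoles** are two sequences $\hat{\mathcal D}^M_{mp}=\{\nu^M_{a_p\dots a_1}\}_{p\ge1}$, $\hat{\mathcal D}^S_{mp}=\{\nu^S_{a_p\dots a_1}\}_{p\ge1}$ of real symmetric trace free tensors with vanishing mass dipole, $\nu^M_{a}=0$. **The map $\Theta$.** Given abstract null data, put $\phi=\sum_{p\ge1}\frac1{p!}\psi_{(p)}$, $S=\sum_{p\ge2}\frac1{(p-2)!}\Psi_{(p)}$ (formal sums of symmetric trace free tensors, the index giving the valence), and let $\phi_M$ be the formal sum with valence-$0$ part $1$ and $\phi_M\odot\phi_M=1-\phi\odot\phi$.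 For $A=M,S$ put $P^A_0=\phi_M$ resp. $P^A_0=\phi$, and, with $(DX)_{(q)}=(q-s)X_{(q)}$ for a formal sum $X$ belonging to a tensor field of valence $s$, let Hansen's recursion $$P^A_1=DP^A_0,\qquad P^A_{s+1}=DP^A_s-\tfrac12 s(2s-1)\,P^A_{s-1}\odot S\quad(s\ge1)$$ define $P^A_s$ (of valence $s$). Then $\Theta$ sends the null data to $\nu^A_{a_p\dots a_1}=$ the valence-$p$ part of $P^A_p$. **Theorem.** (i) *$\Theta$ is the relation between null data and Hansen's multipoles.* Let $h$ be a smooth Riemannian metric with Levi-Civita derivative $D$ and Ricci tensor $R_{ab}$, and $\phi_M,\phi_S$ smooth functions, near a point $i$ of a three-dimensional manifold, such that $\phi_M(i)=1$, $\phi_S(i)=0$, and $\Omega:=\phi_M^2+\phi_S^2-1$ satisfies $D_a\Omega(i)=0$, $D_aD_b\Omega(i)=2h_{ab}(i)$, and the trace free part of the conformal stationary vacuum field equation $$D_aD_b\Omega=-\Omega R_{ab}-\tfrac12(\Omega-1)D_a\Omega D_b\Omega+2\Omega^2\left(D_a\phi_MD_b\phi_M+D_a\phi_SD_b\phi_S\right)+(\dots)h_{ab}.$$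 In any orthonormal frame, let $\psi_{a_p\dots a_1}=\mathcal{C}(D_{a_p}\cdots D_{a_1}\phi_S)(i)$ for $p\ge1$ and $\Psi_{a_p\dots a_1}=\mathcal{C}(D_{a_p}\cdots D_{a_3}S_{a_2a_1})(i)$ for $p\ge2$, where $S_{ab}$ is the trace free part of $R_{ab}$. Then $\Theta$ maps these null data to the Hansen multipoles $\nu^A_{a_p\dots a_1}=P^A_{a_p\dots a_1}(i)$, $A=M,S$, defined by $P^A=\phi_A$, $P^A_a=D_aP^A$, $P^A_{a_{s+1}\dots a_1}=\mathcal{C}[D_{a_{s+1}}P^A_{a_s\dots a_1}-\frac12s(2s-1)P^A_{a_{s+1}\dots a_3}R_{a_2a_1}]$, $s\ge1$. (ii) *Triangular structure.* For all abstract null data, the multipoles given by $\Theta$ satisfy $$\nu^M_{(1)}=0,\quad \nu^M_{(2)}=-\tfrac12\Psi_{(2)}-\psi_{(1)}\odot\psi_{(1)},\quad \nu^M_{(3)}=-\tfrac12\Psi_{(3)}-3\,\psi_{(1)}\odot\psi_{(2)},\quad \nu^S_{(1)}=\psi_{(1)},\quad\nu^S_{(2)}=\psi_{(2)},$$ $$\nu^M_{(p)}=-\tfrac12\Psi_{(p)}-p\,\psi_{(1)}\odot\psi_{(p-1)}+f^M_{(p)}\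 (p\ge3),\qquad \nu^S_{(p)}=\psi_{(p)}+f^S_{(p)}\ (p\ge2),$$ where $f^M_{(3)}=0$, $f^S_{(2)}=0$, and $f^M_{(p)}$ (resp. $f^S_{(p)}$) is a real linear combination, with coefficients independent of the data, of symmetrized tensor products of the $\psi_{(q)}$ with $1\le q\le p-2$ and the $\Psi_{(q)}$ with $2\le q\le p-1$ (resp. $2\le q\le p$). (iii) *Bijectivity.* $\Theta$ is a bijection from the set of abstract null data onto the set of abstract multipoles. Its inverse is recursive in the order: for every $n$, two sets of null data agree up to valence $n$ if and only if their images under $\Theta$ agree up to valence $n$. -/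

import Mathlib

open Finset
open scoped ContDiff

noncomputable section

namespace Hansen

/-! Tensors on a three-dimensional Euclidean space, given by their components in an orthonormal
frame, and the projector `stfPart` onto their symmetric trace free part. -/

/-- Covariant tensors of valence `p`: the components `T I`, with `I : Fin p → Fin 3` the list of
frame indices, and the Euclidean inner product of components. -/
abbrev Tensor (p : ℕ) : Type := EuclideanSpace ℝ (Fin p → Fin 3)

/-- The symmetric trace free tensors of valence `p`. -/
def stf (p : ℕ) : Submodule ℝ (Tensor p) where
  carrier := {T | (∀ (σ : Equiv.Perm (Fin p)) (I : Fin p → Fin 3), T (I ∘ σ) = T I) ∧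
    ∀ i j : Fin p, i ≠ j → ∀ I : Fin p → Fin 3,
      ∑ a : Fin 3, T (Function.update (Function.update I i a) j a) = 0}
  add_mem' := by
    rintro T T' ⟨h1, h2⟩ ⟨h1', h2'⟩
    refine ⟨fun σ I => ?_, fun i j hij I => ?_⟩
    · simp only [PiLp.add_apply, h1 σ I, h1' σ I]
    · simp only [PiLp.add_apply, Finset.sum_add_distrib, h2 i j hij I, h2' i j hij I, add_zero]
  zero_mem' := ⟨fun _ _ => rfl, fun _ _ _ _ => by simp⟩
  smul_mem' := by
    rintro r T ⟨h1, h2⟩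
    refine ⟨fun σ I => ?_, fun i j hij I => ?_⟩
    · simp only [PiLp.smul_apply, h1 σ I]
    · simp only [PiLp.smul_apply, ← Finset.smul_sum, h2 i j hij I, smul_zero]

/-- The projector `𝒞` onto the symmetric trace free part: the orthogonal projection. -/
def stfPart {p : ℕ} (T : Tensor p) : Tensor p := (stf p).starProjection T

lemma stfPart_mem {p : ℕ} (T : Tensor p) : stfPart T ∈ stf p :=
  Submodule.starProjection_apply_mem _ _

lemma stfPart_zero {p : ℕ} : stfPart (0 : Tensor p) = 0 := map_zero _

/-- The tensor product `T_{a…} U_{b…}`, the indices of `T` coming first. -/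
def tprod {j l p : ℕ} (h : j + l = p) (T : Tensor j) (U : Tensor l) : Tensor p :=
  WithLp.toLp 2 fun I =>
    T (fun t => I (Fin.cast h (Fin.castAdd l t))) * U (fun t => I (Fin.cast h (Fin.natAdd j t)))

/-- The symmetrized tensor product `𝒞(T ⊗ U)`; in space-spinor form it is the total
symmetrization of the product of two symmetric spinors. -/
def symProd {j l p : ℕ} (h : j + l = p) (T : Tensor j) (U : Tensor l) : Tensor p :=
  stfPart (tprod h T U)

/-- A scalar as a tensor of valence `0`. -/
def scalar (r : ℝ) : Tensor 0 := WithLp.toLp 2 fun _ => r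

lemma scalar_mem (r : ℝ) : scalar r ∈ stf 0 :=
  ⟨fun _ _ => rfl, fun i => i.elim0⟩

/-! Abstract null data and abstract multipoles. -/

/-- Abstract null data: symmetric trace free tensors `ψ_{a_p…a_1}`, `p ≥ 1`, and `Ψ_{a_p…a_1}`,
`p ≥ 2`, without any estimates. Outside of these ranges the entries are set to `0`. -/
@[ext] structure NullData where
  psi : (p : ℕ) → Tensor p
  Psi : (p : ℕ) → Tensor p
  psi_mem : ∀ p, psi p ∈ stf p
  Psi_mem : ∀ p, Psi p ∈ stf p
  psi_zero : psi 0 = 0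
  Psi_zero : Psi 0 = 0
  Psi_one : Psi 1 = 0

/-- Abstract multipoles: sequences of symmetric trace free tensors `ν^M_{a_p…a_1}`,
`ν^S_{a_p…a_1}`, `p ≥ 1`, with vanishing mass dipole `ν^M_a`. The entries for `p = 0` are the
normalized monopoles `ν^M = m = 1`, `ν^S = 0` and carry no freedom. -/
@[ext] structure Multipoles where
  nuM : (p : ℕ) → Tensor p
  nuS : (p : ℕ) → Tensor p
  nuM_mem : ∀ p, nuM p ∈ stf p
  nuS_mem : ∀ p, nuS p ∈ stf p
  nuM_zero : nuM 0 = scalar 1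
  nuS_zero : nuS 0 = scalar 0
  nuM_one : nuM 1 = 0

/-! The map `Θ`. A `SymSeries` records the symmetrized normal expansion at `i` of a tensor field
`T` of valence `s`: its entry of valence `q = s + k` is `(1 / k!) 𝒞(D_{a_k} … D_{a_1} T)(i)`.
Tensor products of fields turn into `symMul`, and `D T` has the entries `(q - s) • X q`. -/

abbrev SymSeries : Type := (q : ℕ) → Tensor q

/-- Product of two symmetrized expansions. -/
def symMul (X Y : SymSeries) : SymSeries := fun q =>
  ∑ x ∈ (antidiagonal q).attach, symProd (mem_antidiagonal.mp x.2) (X x.1.1) (Y x.1.2)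

/-- Hansen's recursion
`P_{s+1} = 𝒞[D P_s - ½ s (2s - 1) P_{s-1} ⊗ Ric]`, `P_1 = D P_0`, for symmetrized expansions.
`S` is the expansion of the trace free Ricci tensor (the trace of `Ric` drops out under `𝒞`),
`X` is the expansion of the potential `P_0`, and the result is the expansion of `P_s`. -/
def hansenSeries (S X : SymSeries) : ℕ → SymSeries
  | 0 => X
  | 1 => fun q => (q : ℝ) • X q
  | s + 2 => fun q => ((q : ℝ) - (s + 1)) • hansenSeries S X (s + 1) q
      - (1 / 2 * (s + 1) * (2 * (s + 1) - 1) : ℝ) • symMul (hansenSeries S X s) S q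

namespace NullData

/-- The expansion of `φ = φ_S`, where `𝒞(D_{a_p} … D_{a_1} φ)(i) = ψ_{a_p…a_1}`. -/
def phiSeries (D : NullData) : SymSeries := fun q => ((q.factorial : ℝ)⁻¹) • D.psi q

/-- The expansion of `S_{ab}`, where `𝒞(D_{a_p} … D_{a_3} S_{a_2 a_1})(i) = Ψ_{a_p…a_1}`. -/
def ricciSeries (D : NullData) : SymSeries := fun q => (((q - 2).factorial : ℝ)⁻¹) • D.Psi q

/-- The expansion of `φ_M = (1 + Ω - φ²)^{1/2}`. By the field equation for `D_a D_b Ω` and by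
`Ω(i) = 0`, `D_a Ω(i) = 0`, all the `𝒞(D_{a_p} … D_{a_1} Ω)(i)` vanish, and so `φ_M` has the
expansion `X` that is determined by `X 0 = 1` and `X · X = 1 - φ · φ`. -/
def phiMSeries (D : NullData) : SymSeries
  | 0 => scalar 1
  | q + 1 => -((1 / 2 : ℝ) • (symMul D.phiSeries D.phiSeries (q + 1)
      + ∑ j : Fin q, symProd (show ((j : ℕ) + 1) + (q - j) = q + 1 by have := j.2; omega)
          (D.phiMSeries (j + 1)) (D.phiMSeries (q - j))))
  decreasing_by all_goals (have := j.2; omega)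

end NullData

lemma symProd_mem {j l p : ℕ} (h : j + l = p) (T : Tensor j) (U : Tensor l) :
    symProd h T U ∈ stf p := stfPart_mem _

lemma symMul_mem (X Y : SymSeries) (q : ℕ) : symMul X Y q ∈ stf q :=
  Submodule.sum_mem _ fun _ _ => symProd_mem _ _ _

lemma hansenSeries_mem (S X : SymSeries) (hX : ∀ q, X q ∈ stf q) (s q : ℕ) :
    hansenSeries S X s q ∈ stf q := by
  induction s using Nat.strong_induction_on with
  | _ s ih =>
    match s, ih with
    | 0, _ => simpa [hansenSeries] using hX q
    | 1, _ => simpa only [hansenSeries] using (stf q).smul_mem _ (hX q)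
    | s + 2, ih =>
      rw [hansenSeries]
      exact (stf q).sub_mem ((stf q).smul_mem _ (ih (s + 1) (by omega)))
        ((stf q).smul_mem _ (symMul_mem _ _ _))

lemma phiSeries_mem (D : NullData) (q : ℕ) : D.phiSeries q ∈ stf q :=
  (stf q).smul_mem _ (D.psi_mem q)

lemma phiMSeries_mem (D : NullData) (q : ℕ) : D.phiMSeries q ∈ stf q := by
  cases q with
  | zero => rw [NullData.phiMSeries]; exact scalar_mem 1
  | succ q =>
    rw [NullData.phiMSeries]
    exact (stf _).neg_mem ((stf _).smul_mem _ ((stf _).add_mem (symMul_mem _ _ _)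
      (Submodule.sum_mem _ fun _ _ => symProd_mem _ _ _)))

lemma phiMSeries_one (D : NullData) : D.phiMSeries 1 = 0 := by
  have h0 : D.phiSeries 0 = 0 := by simp [NullData.phiSeries, D.psi_zero]
  have key : symMul D.phiSeries D.phiSeries 1 = 0 := by
    refine Finset.sum_eq_zero fun x _ => ?_
    obtain ⟨⟨j, l⟩, hx⟩ := x
    have hjl : j + l = 1 := mem_antidiagonal.mp hx
    have : tprod hjl (D.phiSeries j) (D.phiSeries l) = 0 := by
      obtain rfl | rfl : j = 0 ∨ l = 0 := by omega
      · ext I; simp [tprod, h0]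
      · ext I; simp [tprod, h0]
    simp only [symProd]
    rw [this, stfPart_zero]
  rw [NullData.phiMSeries, key]
  simp

/-- The map `Θ` from abstract null data to abstract multipoles: the multipoles are the values at
`i` of Hansen's fields `P^M_{a_p…a_1}`, `P^S_{a_p…a_1}`. -/
def Theta (D : NullData) : Multipoles where
  nuM p := hansenSeries D.ricciSeries D.phiMSeries p p
  nuS p := hansenSeries D.ricciSeries D.phiSeries p p
  nuM_mem p := hansenSeries_mem _ _ (phiMSeries_mem D) p p
  nuS_mem p := hansenSeries_mem _ _ (phiSeries_mem D) p p
  nuM_zero := by rw [hansenSeries, NullData.phiMSeries]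
  nuS_zero := by
    rw [hansenSeries]
    ext I
    simp [NullData.phiSeries, D.psi_zero, scalar]
  nuM_one := by simp only [hansenSeries, phiMSeries_one, smul_zero]

/-- The tensors of valence `p` depending on null data that are real linear combinations (with
coefficients independent of the data) of symmetrized tensor products of the `ψ_{a_q…a_1}`,
`1 ≤ q ≤ a`, and the `Ψ_{a_q…a_1}`, `2 ≤ q ≤ b`. -/
inductive IsSymCombination (a b : ℕ) : (p : ℕ) → (NullData → Tensor p) → Prop
  | psi (q : ℕ) : 1 ≤ q → q ≤ a → IsSymCombination a b q fun D => D.psi q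
  | Psi (q : ℕ) : 2 ≤ q → q ≤ b → IsSymCombination a b q fun D => D.Psi q
  | zero (p : ℕ) : IsSymCombination a b p fun _ => 0
  | add {p : ℕ} {f g : NullData → Tensor p} : IsSymCombination a b p f →
      IsSymCombination a b p g → IsSymCombination a b p fun D => f D + g D
  | smul {p : ℕ} (r : ℝ) {f : NullData → Tensor p} : IsSymCombination a b p f →
      IsSymCombination a b p fun D => r • f D
  | mul {j l p : ℕ} (h : j + l = p) {f : NullData → Tensor j} {g : NullData → Tensor l} :
      IsSymCombination a b j f → IsSymCombination a b l g →
      IsSymCombination a b p fun D => symProd h (f D) (g D)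

/-! Null data and Hansen multipoles of actual conformal stationary fields near the point `i`.
A coordinate chart identifies a neighbourhood of `i` with a neighbourhood of `0` in `ℝ³`. -/

/-- The coordinate space. -/
abbrev Chart : Type := EuclideanSpace ℝ (Fin 3)

/-- A smooth Riemannian metric `h` near `i` (the origin) together with a smooth `h`-orthonormal
frame `c_1, c_2, c_3`. -/
structure FramedMetric where
  N : Set Chart
  isOpen_N : IsOpen N
  zero_mem_N : (0 : Chart) ∈ N
  h : Chart → Chart →L[ℝ] Chart →L[ℝ] ℝ
  smooth_h : ContDiffOn ℝ ∞ h N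
  symm_h : ∀ x ∈ N, ∀ v w, h x v w = h x w v
  pos_h : ∀ x ∈ N, ∀ v, v ≠ 0 → 0 < h x v v
  c : Fin 3 → Chart → Chart
  smooth_c : ∀ a, ContDiffOn ℝ ∞ (c a) N
  orthonormal : ∀ x ∈ N, ∀ a b, h x (c a x) (c b x) = if a = b then 1 else 0

namespace FramedMetric

variable (g : FramedMetric)

/-- The component `h([c_a, c_b], c_d)` of a commutator of frame fields. -/
def comm (a b d : Fin 3) (x : Chart) : ℝ :=
  g.h x (VectorField.lieBracket ℝ (g.c a) (g.c b) x) (g.c d x)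

/-- The Levi-Civita connection coefficients `Γ_a^b_d`, that is `D_{c_a} c_d = Γ_a^b_d c_b`, by
Koszul's formula in an orthonormal frame. -/
def conn (a b d : Fin 3) (x : Chart) : ℝ :=
  1 / 2 * (g.comm a d b x - g.comm d b a x + g.comm b a d x)

/-- The covariant derivative `D_a T_{a_p…a_1}` in frame components; the index of the derivative
comes first. -/
def covD {p : ℕ} (T : Chart → Tensor p) (x : Chart) : Tensor (p + 1) :=
  WithLp.toLp 2 fun I => fderiv ℝ T x (g.c (I 0) x) (Fin.tail I)
    - ∑ k : Fin p, ∑ b : Fin 3,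
        g.conn (I 0) b (I k.succ) x * T x (Function.update (Fin.tail I) k b)

/-- The components of the Riemann tensor: `R(c_a, c_b) c_e = riem a b e d • c_d`, with
`R(X, Y) = D_X D_Y - D_Y D_X - D_{[X, Y]}`. -/
def riem (a b e d : Fin 3) (x : Chart) : ℝ :=
  fderiv ℝ (g.conn b d e) x (g.c a x) - fderiv ℝ (g.conn a d e) x (g.c b x)
    + ∑ f : Fin 3, (g.conn a d f x * g.conn b f e x - g.conn b d f x * g.conn a f e x
        - g.comm a b f x * g.conn f d e x)

/-- The Ricci tensor `R_{be} = R^a_{eab}`. -/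
def ricci (x : Chart) : Tensor 2 :=
  WithLp.toLp 2 fun I => ∑ a : Fin 3, g.riem a (I 0) (I 1) a x

/-- The iterated covariant derivatives `D_{a_p} … D_{a_1} f` of a function. -/
def iterD (f : Chart → ℝ) : (p : ℕ) → Chart → Tensor p
  | 0 => fun x => scalar (f x)
  | p + 1 => g.covD (iterD f p)

/-- The iterated covariant derivatives `D_{a_{p+2}} … D_{a_3} S_{a_2 a_1}` of the trace free part
of the Ricci tensor. -/
def iterDS : (p : ℕ) → Chart → Tensor (p + 2)
  | 0 => fun x => stfPart (g.ricci x)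
  | p + 1 => g.covD (iterDS p)

/-- Hansen's tensor fields `P_{a_s…a_1}` of a potential `f`: `P = f`, `P_a = D_a P`,
`P_{a_{s+1}…a_1} = 𝒞[D_{a_{s+1}} P_{a_s…a_1} - ½ s (2s - 1) P_{a_{s+1}…a_3} R_{a_2 a_1}]`. -/
def hansenField (f : Chart → ℝ) : (s : ℕ) → Chart → Tensor s
  | 0 => fun x => scalar (f x)
  | 1 => g.covD (p := 0) fun x => scalar (f x)
  | s + 2 => fun x => stfPart (g.covD (hansenField f (s + 1)) x
      - (1 / 2 * (s + 1) * (2 * (s + 1) - 1) : ℝ) • tprod rfl (hansenField f s x) (g.ricci x))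

end FramedMetric

/-- Conformal stationary vacuum fields near `i`, in the conformal gauge in which
`Ω = φ_M² + φ_S² - 1`, with mass `m = 1` and vanishing angular momentum monopole. Of the field
equations only the trace free part of
`D_a D_b Ω = -Ω R_ab - ½ (Ω - 1) D_a Ω D_b Ω + 2 Ω² (D_a φ_M D_b φ_M + D_a φ_S D_b φ_S) + (…) h_ab`
is required, so that all solutions of the full system are included. -/
structure StationaryFields extends FramedMetric where
  phiM : Chart → ℝ
  phiS : Chart → ℝ
  smooth_phiM : ContDiffOn ℝ ∞ phiM N
  smooth_phiS : ContDiffOn ℝ ∞ phiS N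
  phiM_zero : phiM 0 = 1
  phiS_zero : phiS 0 = 0
  Omega : Chart → ℝ
  Omega_eq : ∀ x, Omega x = phiM x ^ 2 + phiS x ^ 2 - 1
  D_Omega : toFramedMetric.iterD Omega 1 0 = 0
  DD_Omega : toFramedMetric.iterD Omega 2 0
    = WithLp.toLp 2 fun I : Fin 2 → Fin 3 => if I 0 = I 1 then 2 else 0
  field_eq : ∀ x ∈ N, stfPart (toFramedMetric.iterD Omega 2 x)
    = stfPart (-(Omega x • toFramedMetric.ricci x)
      - (1 / 2 * (Omega x - 1)) •
          tprod rfl (toFramedMetric.iterD Omega 1 x) (toFramedMetric.iterD Omega 1 x)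
      + (2 * Omega x ^ 2) •
          (tprod rfl (toFramedMetric.iterD phiM 1 x) (toFramedMetric.iterD phiM 1 x)
            + tprod rfl (toFramedMetric.iterD phiS 1 x) (toFramedMetric.iterD phiS 1 x)))

/-- The null data `𝒞(D_{a_p} … D_{a_1} φ_S)(i)`, `p ≥ 1`, and
`𝒞(D_{a_p} … D_{a_3} S_{a_2 a_1})(i)`, `p ≥ 2`, in the given orthonormal frame at `i`. -/
def StationaryFields.nullData (F : StationaryFields) : NullData where
  psi p := stfPart (F.iterD F.phiS p 0)
  Psi p := match p with
    | 0 => 0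
    | 1 => 0
    | p + 2 => stfPart (F.iterDS p 0)
  psi_mem _ := stfPart_mem _
  Psi_mem p := match p with
    | 0 => (stf 0).zero_mem
    | 1 => (stf 1).zero_mem
    | _ + 2 => stfPart_mem _
  psi_zero := by
    have : F.toFramedMetric.iterD F.phiS 0 0 = 0 := by
      ext I; simp [FramedMetric.iterD, scalar, F.phiS_zero]
    rw [this, stfPart_zero]
  Psi_zero := rfl
  Psi_one := rfl

end Hansen

end

noncomputable section

namespace Hansen

/-! ### Symbols of tensors: functions on the null cone -/

/-! A tensor `T` of valence `p` is replaced by its symbol, the polynomial `T_{a…b} X^a … X^b`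
restricted to the null cone `|X|² = 0`. The symbol is injective on symmetric trace free tensors
(`symbol_injOn`) and does not see what the projector removes (`symbol_stfPart`). Hence symmetrized
products become products in the commutative ring `ConeRing`, formal sums of tensors become power
series over it, and identities between symmetric trace free tensors are ring identities.

For (i), the connection coefficients in an orthonormal frame are antisymmetric, so they act on
polynomials by derivations that annihilate `|X|²`. Therefore the symbol of `D T` depends only on the
symbol of the field `T` (`symbol_covD_congr`) and obeys the Leibniz rule (`symbol_covD_tprod`). The
series of symbols of the iterated derivatives is then multiplicative (`expansion_tprod`), and `D`
multiplies its valence-`q` coefficient by `q - s` (`coeff_expansion_covD`); no normal coordinates or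
convergence are involved. Hansen's recursion for fields thus becomes the recursion defining `Θ`. The
field equation expresses `q (q - 1) Ω_q` by terms that vanish once the lower coefficients of `Ω` do,
so the expansion of `Ω` is zero (`expansion_Omega`), and `φ_M` is the square root of `1 - φ_S²` with
constant term `1`.

For (ii), induction on `s` isolates the top-order terms in the valence-`q` part of `P_s`. The
potential enters through `D` with the factor `q (q - 1) … (q - s + 1)`. The tensor `Ψ_q` enters only
through the monopole `1` of `φ_M` in the step from `P_1` to `P_2`, with factor `-1/2`, later
multiplied by `(q - 2) (q - 3) …`. At `s = q` these factors cancel the factorials of the expansions.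
In `φ_M` itself, `ψ_{q-1}` occurs only in `-φ_1 φ_{q-1}`, which yields the term with coefficient
`-q`.

For (iii), at each valence `ν^S_p` is `ψ_p` and `ν^M_p` is `-½ Ψ_p`, each up to terms in data of
lower valence, so the data are found recursively. -/

/-- The quadratic form `|X|²`. -/
def quadric : MvPolynomial (Fin 3) ℝ := ∑ a, MvPolynomial.X a ^ 2

/-- The coordinate ring of the null cone. -/
abbrev ConeRing : Type := MvPolynomial (Fin 3) ℝ ⧸ Ideal.span {quadric}

/-- The monomial `X^I`. -/
def mono {p : ℕ} (I : Fin p → Fin 3) : MvPolynomial (Fin 3) ℝ := ∏ k, MvPolynomial.X (I k)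

/-- The homogeneous polynomial `T_{a…b} X^a … X^b`. -/
def polyOf {p : ℕ} : Tensor p →ₗ[ℝ] MvPolynomial (Fin 3) ℝ where
  toFun T := ∑ I, T I • mono I
  map_add' T U := by simp [add_smul, Finset.sum_add_distrib]
  map_smul' r T := by simp [mul_smul, Finset.smul_sum]

lemma polyOf_apply {p : ℕ} (T : Tensor p) : polyOf T = ∑ I, T I • mono I := rfl

/-- The restriction of `T_{a…b} X^a … X^b` to the null cone. -/
def symbol {p : ℕ} : Tensor p →ₗ[ℝ] ConeRing :=
  (Ideal.Quotient.mkₐ ℝ (Ideal.span {quadric})).toLinearMap ∘ₗ polyOf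

lemma symbol_apply {p : ℕ} (T : Tensor p) :
    symbol T = Ideal.Quotient.mk (Ideal.span {quadric}) (polyOf T) := rfl

lemma symbol_eq_zero_iff_dvd {p : ℕ} (T : Tensor p) : symbol T = 0 ↔ quadric ∣ polyOf T := by
  rw [symbol_apply, Ideal.Quotient.eq_zero_iff_mem, Ideal.mem_span_singleton]

lemma mono_perm {p : ℕ} (I : Fin p → Fin 3) (σ : Equiv.Perm (Fin p)) : mono (I ∘ σ) = mono I :=
  Equiv.prod_comp σ fun k => MvPolynomial.X (I k)

lemma mono_erase {p : ℕ} (I : Fin p → Fin 3) (k : Fin p) :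
    mono I = (∏ j ∈ univ.erase k, MvPolynomial.X (I j)) * MvPolynomial.X (I k) := by
  rw [mono, ← Finset.prod_erase_mul _ _ (Finset.mem_univ k)]

lemma mono_update {p : ℕ} (I : Fin p → Fin 3) (k : Fin p) (d : Fin 3) :
    mono (Function.update I k d)
      = (∏ j ∈ univ.erase k, MvPolynomial.X (I j)) * MvPolynomial.X d := by
  rw [mono_erase _ k, Function.update_self]
  congr 1
  refine Finset.prod_congr rfl fun j hj => ?_
  rw [Function.update_of_ne (Finset.ne_of_mem_erase hj)]

lemma mono_append {j l : ℕ} (I : Fin (j + l) → Fin 3) :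
    mono I = mono (fun t => I (Fin.castAdd l t)) * mono (fun t => I (Fin.natAdd j t)) :=
  Fin.prod_univ_add _

lemma mono_succ {p : ℕ} (I : Fin (p + 1) → Fin 3) :
    mono I = MvPolynomial.X (I 0) * mono (Fin.tail I) :=
  Fin.prod_univ_succ _

lemma polyOf_tprod {j l p : ℕ} (h : j + l = p) (T : Tensor j) (U : Tensor l) :
    polyOf (tprod h T U) = polyOf T * polyOf U := by
  subst h
  simp only [polyOf_apply, Finset.sum_mul_sum, ← Fintype.sum_prod_type']
  refine Fintype.sum_equiv ((Equiv.arrowCongr finSumFinEquiv.symm (Equiv.refl _)).trans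
    (Equiv.sumArrowEquivProdArrow _ _ _)) _ _ fun I => ?_
  rw [mono_append]
  simp only [tprod, smul_mul_smul_comm]
  rfl

lemma symbol_tprod {j l p : ℕ} (h : j + l = p) (T : Tensor j) (U : Tensor l) :
    symbol (tprod h T U) = symbol T * symbol U := by
  simp only [symbol_apply, polyOf_tprod, map_mul]

lemma polyOf_scalar (r : ℝ) : polyOf (scalar r) = algebraMap ℝ _ r := by
  rw [polyOf_apply, Fintype.sum_unique, scalar, mono, Fin.prod_univ_zero,
    Algebra.algebraMap_eq_smul_one]

lemma symbol_scalar (r : ℝ) : symbol (scalar r) = algebraMap ℝ ConeRing r := by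
  rw [symbol_apply, polyOf_scalar]
  rfl

/-! ### The kernel of the symbol -/

/-- The exponent vector of `X^I`. -/
def expo {p : ℕ} (I : Fin p → Fin 3) : Fin 3 →₀ ℕ := ∑ k, Finsupp.single (I k) 1

lemma mono_eq_monomial {p : ℕ} (I : Fin p → Fin 3) :
    mono I = MvPolynomial.monomial (expo I) 1 := by
  simp only [mono, expo, MvPolynomial.X, MvPolynomial.monomial_sum_one]

/-- The exponents count the fibres of the index lists; bijections between fibres of equal size glue
to a permutation. -/
lemma exists_perm_of_expo_eq {p : ℕ} {I J : Fin p → Fin 3} (h : expo I = expo J) :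
    ∃ σ : Equiv.Perm (Fin p), I = J ∘ σ := by
  have key (K : Fin p → Fin 3) (c : Fin 3) : expo K c = Fintype.card {k // K k = c} := by
    rw [expo, Finsupp.finsetSum_apply, Fintype.card_subtype, Finset.card_filter]
    exact Finset.sum_congr rfl fun k _ => by rw [Finsupp.single_apply]
  have e (c : Fin 3) : {k // I k = c} ≃ {k // J k = c} :=
    Fintype.equivOfCardEq (by rw [← key, ← key, h])
  exact ⟨Equiv.ofFiberEquiv e, funext fun k => (Equiv.ofFiberEquiv_map e k).symm⟩

lemma exists_expo_eq (m : Fin 3 →₀ ℕ) : ∃ J : Fin m.degree → Fin 3, expo J = m := by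
  suffices H : ∀ (n : ℕ) (m : Fin 3 →₀ ℕ), m.degree = n → ∃ J : Fin n → Fin 3, expo J = m from
    H _ m rfl
  intro n
  induction n with
  | zero =>
    intro m hm
    exact ⟨Fin.elim0, by rw [(Finsupp.degree_eq_zero_iff m).1 hm]; rfl⟩
  | succ n ih =>
    intro m hm
    obtain ⟨a, ha⟩ : ∃ a, m a ≠ 0 := by
      by_contra! H
      have : m = 0 := Finsupp.ext H
      simp [this] at hm
    have hle : Finsupp.single a 1 ≤ m := by
      rw [Finsupp.single_le_iff]; omega
    obtain ⟨J, hJ⟩ := ih (m - Finsupp.single a 1) (by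
      have := congrArg Finsupp.degree (tsub_add_cancel_of_le hle)
      rw [map_add, Finsupp.degree_single, hm] at this
      omega)
    refine ⟨Fin.cons a J, ?_⟩
    rw [expo, Fin.sum_univ_succ]
    simp only [Fin.cons_zero, Fin.cons_succ]
    rw [← expo, hJ, add_comm]
    exact tsub_add_cancel_of_le hle

lemma degree_expo {p : ℕ} (I : Fin p → Fin 3) : (expo I).degree = p := by
  simp [expo]

open Classical in
/-- The functional on polynomials that sends `X^I` to `T I`, for a symmetric tensor `T`. -/
def pairing {p : ℕ} (T : Tensor p) : MvPolynomial (Fin 3) ℝ →ₗ[ℝ] ℝ :=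
  (MvPolynomial.basisMonomials (Fin 3) ℝ).constr ℝ fun m =>
    -- For symmetric `T` the choice of `I` is immaterial by `exists_perm_of_expo_eq`. Monomials of
    -- degree other than `p` are sent to `0`.
    if h : ∃ I : Fin p → Fin 3, expo I = m then T h.choose else 0

lemma pairing_monomial_of_ne {p : ℕ} (T : Tensor p) {m : Fin 3 →₀ ℕ} (h : m.degree ≠ p) :
    pairing T (MvPolynomial.monomial m 1) = 0 := by
  have := (MvPolynomial.basisMonomials (Fin 3) ℝ).constr_basis ℝ (fun m =>
    if h : ∃ I : Fin p → Fin 3, expo I = m then T h.choose else 0) m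
  rw [MvPolynomial.coe_basisMonomials] at this
  rw [pairing, this, dif_neg]
  rintro ⟨I, rfl⟩
  exact h (degree_expo I)

lemma pairing_mono {p : ℕ} {T : Tensor p} (hT : T ∈ stf p) (I : Fin p → Fin 3) :
    pairing T (mono I) = T I := by
  have := (MvPolynomial.basisMonomials (Fin 3) ℝ).constr_basis ℝ (fun m =>
    if h : ∃ I : Fin p → Fin 3, expo I = m then T h.choose else 0) (expo I)
  rw [MvPolynomial.coe_basisMonomials] at this
  have hex : ∃ J : Fin p → Fin 3, expo J = expo I := ⟨I, rfl⟩
  rw [mono_eq_monomial, pairing, this, dif_pos hex]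
  obtain ⟨σ, hσ⟩ := exists_perm_of_expo_eq hex.choose_spec
  conv_lhs => rw [hσ]
  exact hT.1 σ I

/-- Multiplying `X^J` by `|X|²` prepends a pair of equal indices and sums over it, so the functional
returns a trace of `T`. -/
lemma pairing_quadric_mul {p : ℕ} {T : Tensor p} (hT : T ∈ stf p)
    (f : MvPolynomial (Fin 3) ℝ) : pairing T (quadric * f) = 0 := by
  suffices H : pairing T ∘ₗ LinearMap.mulLeft ℝ quadric = 0 from LinearMap.congr_fun H f
  refine (MvPolynomial.basisMonomials (Fin 3) ℝ).ext fun m => ?_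
  rw [MvPolynomial.coe_basisMonomials]
  simp only [LinearMap.comp_apply, LinearMap.mulLeft_apply, LinearMap.zero_apply]
  obtain ⟨J, hJ⟩ := exists_expo_eq m
  generalize m.degree = r at J
  subst hJ
  have hmul (a : Fin 3) : (MvPolynomial.X a ^ 2 : MvPolynomial (Fin 3) ℝ)
      * MvPolynomial.monomial (expo J) 1 = mono (Fin.cons a (Fin.cons a J)) := by
    rw [mono_succ, mono_succ, ← mono_eq_monomial]
    simp only [Fin.cons_zero, Fin.tail_cons]
    ring
  rw [quadric, Finset.sum_mul, map_sum]
  simp only [hmul]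
  by_cases hp : r + 2 = p
  · subst hp
    have h01 : (0 : Fin (r + 2)) ≠ 1 := by simp
    rw [← hT.2 0 1 h01 (Fin.cons 0 (Fin.cons 0 J))]
    refine Finset.sum_congr rfl fun a _ => ?_
    rw [pairing_mono hT]
    refine congrArg (fun K => T K) (funext fun k => ?_)
    refine Fin.cases ?_ (fun k => ?_) k
    · simp
    · refine Fin.cases ?_ (fun k => ?_) k
      · simp
      · have h1 : k.succ.succ ≠ 1 := by
          intro h; simpa using congrArg Fin.val h
        rw [Function.update_of_ne h1, Function.update_of_ne (Fin.succ_ne_zero _)]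
        simp
  · refine Finset.sum_eq_zero fun a _ => ?_
    rw [mono_eq_monomial]
    exact pairing_monomial_of_ne T (by rw [degree_expo]; exact hp)

lemma pairing_polyOf {p : ℕ} {T : Tensor p} (hT : T ∈ stf p) (U : Tensor p) :
    pairing T (polyOf U) = ∑ I, U I * T I := by
  rw [polyOf_apply, map_sum]
  simp only [map_smul, pairing_mono hT, smul_eq_mul]

/-- The pairing of `T` with its own polynomial is `∑ T_I²`, while it vanishes on multiples of
`|X|²`. -/
lemma eq_zero_of_symbol_eq_zero {p : ℕ} {T : Tensor p} (hT : T ∈ stf p) (h : symbol T = 0) :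
    T = 0 := by
  obtain ⟨f, hf⟩ := (symbol_eq_zero_iff_dvd T).1 h
  have h1 := pairing_polyOf hT T
  rw [hf, pairing_quadric_mul hT] at h1
  have h2 := (Finset.sum_eq_zero_iff_of_nonneg fun I _ => mul_self_nonneg (T I)).1 h1.symm
  ext I
  exact mul_self_eq_zero.1 (h2 I (Finset.mem_univ I))

lemma symbol_injOn {p : ℕ} {T U : Tensor p} (hT : T ∈ stf p) (hU : U ∈ stf p)
    (h : symbol T = symbol U) : T = U :=
  sub_eq_zero.1 (eq_zero_of_symbol_eq_zero ((stf p).sub_mem hT hU) (by rw [map_sub, h, sub_self]))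

lemma polyOf_single {p : ℕ} (I : Fin p → Fin 3) :
    polyOf (EuclideanSpace.single I (1 : ℝ)) = mono I := by
  rw [polyOf_apply, Finset.sum_eq_single I]
  · simp
  · intro J _ hJ
    simp [hJ]
  · simp

/-- The kernel contains the differences of basis tensors with permuted indices and the contracted
sums of basis tensors; orthogonality to these is precisely symmetry and vanishing of traces. -/
lemma ker_symbol_orthogonal_le (p : ℕ) :
    (LinearMap.ker (symbol (p := p)))ᗮ ≤ stf p := by
  intro V hV
  rw [Submodule.mem_orthogonal'] at hV
  have hval (I : Fin p → Fin 3) : inner ℝ V (EuclideanSpace.single I (1 : ℝ)) = V I := by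
    rw [EuclideanSpace.inner_single_right]
    simp
  refine ⟨fun σ I => ?_, fun i j hij I => ?_⟩
  · have := hV (EuclideanSpace.single (I ∘ σ) (1 : ℝ) - EuclideanSpace.single I (1 : ℝ)) (by
      rw [LinearMap.mem_ker, symbol_apply, map_sub, polyOf_single, polyOf_single, mono_perm,
        sub_self, map_zero])
    rw [inner_sub_right, hval, hval] at this
    linarith
  · have := hV (∑ a : Fin 3, EuclideanSpace.single
      (Function.update (Function.update I i a) j a) (1 : ℝ)) (by
      rw [LinearMap.mem_ker, symbol_eq_zero_iff_dvd, map_sum]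
      refine ⟨∏ k ∈ (univ.erase j).erase i, MvPolynomial.X (I k), ?_⟩
      rw [quadric, Finset.sum_mul]
      refine Finset.sum_congr rfl fun a _ => ?_
      rw [polyOf_single, mono_update, ← Finset.prod_erase_mul _ _
        (Finset.mem_erase.2 ⟨hij, Finset.mem_univ i⟩), Function.update_self]
      rw [Finset.prod_congr rfl (g := fun k => MvPolynomial.X (I k)) fun k hk => by
        rw [Function.update_of_ne (Finset.ne_of_mem_erase hk)]]
      ring)
    rw [inner_sum] at this
    simpa only [hval] using this

/-- Taking orthogonal complements in `ker_symbol_orthogonal_le`; in finite dimension the double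
complement of the kernel is the kernel. -/
lemma symbol_eq_zero_of_stfPart_eq_zero {p : ℕ} {T : Tensor p} (h : stfPart T = 0) :
    symbol T = 0 := by
  have h1 : T ∈ (stf p)ᗮ := (Submodule.starProjection_apply_eq_zero_iff _).1 h
  have h2 := Submodule.orthogonal_le (ker_symbol_orthogonal_le p) h1
  rwa [Submodule.orthogonal_orthogonal, LinearMap.mem_ker] at h2

lemma stfPart_of_mem {p : ℕ} {T : Tensor p} (hT : T ∈ stf p) : stfPart T = T :=
  Submodule.starProjection_eq_self_iff.2 hT

lemma symbol_stfPart {p : ℕ} (T : Tensor p) : symbol (stfPart T) = symbol T := by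
  have : stfPart (stfPart T - T) = 0 := by
    have : stfPart (stfPart T - T) = stfPart (stfPart T) - stfPart T := map_sub _ _ _
    rw [this, stfPart_of_mem (stfPart_mem T), sub_self]
  exact sub_eq_zero.1 (by rw [← map_sub]; exact symbol_eq_zero_of_stfPart_eq_zero this)

lemma symbol_symProd {j l p : ℕ} (h : j + l = p) (T : Tensor j) (U : Tensor l) :
    symbol (symProd h T U) = symbol T * symbol U := by
  rw [symProd, symbol_stfPart, symbol_tprod]

/-- The formal power series of the symbols of a symmetrized expansion. -/
def toSeries (X : SymSeries) : PowerSeries ConeRing := PowerSeries.mk fun q => symbol (X q)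

lemma coeff_toSeries (X : SymSeries) (q : ℕ) :
    PowerSeries.coeff q (toSeries X) = symbol (X q) := PowerSeries.coeff_mk _ _

lemma symbol_symMul (X Y : SymSeries) (q : ℕ) :
    symbol (symMul X Y q) = ∑ x ∈ antidiagonal q, symbol (X x.1) * symbol (Y x.2) := by
  rw [symMul, map_sum, ← Finset.sum_attach (antidiagonal q)]
  simp only [symbol_symProd]

lemma toSeries_symMul (X Y : SymSeries) : toSeries (symMul X Y) = toSeries X * toSeries Y := by
  ext q
  rw [coeff_toSeries, symbol_symMul, PowerSeries.coeff_mul]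
  simp only [coeff_toSeries]

/-! ### Infinitesimal rotations acting on polynomials -/

/-- The derivation of the polynomial ring with `X_b ↦ Γ_{bd} X_d`. -/
def rotation (Γ : Fin 3 → Fin 3 → ℝ) :
    Derivation ℝ (MvPolynomial (Fin 3) ℝ) (MvPolynomial (Fin 3) ℝ) :=
  MvPolynomial.mkDerivation ℝ fun b => ∑ d, Γ b d • MvPolynomial.X d

lemma rotation_X (Γ : Fin 3 → Fin 3 → ℝ) (b : Fin 3) :
    rotation Γ (MvPolynomial.X b) = ∑ d, Γ b d • MvPolynomial.X d :=
  MvPolynomial.mkDerivation_X _ _ _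

/-- Antisymmetric matrices generate rotations, which preserve `|X|²`. Consequently the derivation
descends to the cone. -/
lemma rotation_quadric {Γ : Fin 3 → Fin 3 → ℝ} (hΓ : ∀ b d, Γ b d = -Γ d b) :
    rotation Γ quadric = 0 := by
  have h (b : Fin 3) : Γ b b = 0 := by linarith [hΓ b b]
  simp only [quadric, Fin.sum_univ_three, map_add, Derivation.leibniz_pow, rotation_X, h,
    hΓ 1 0, hΓ 2 0, hΓ 2 1, MvPolynomial.smul_eq_C_mul, smul_eq_mul, map_zero, map_neg,
    nsmul_eq_mul]
  push_cast
  ring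

lemma quadric_dvd_rotation {Γ : Fin 3 → Fin 3 → ℝ} (hΓ : ∀ b d, Γ b d = -Γ d b)
    {f : MvPolynomial (Fin 3) ℝ} (hf : quadric ∣ f) : quadric ∣ rotation Γ f := by
  obtain ⟨e, rfl⟩ := hf
  rw [Derivation.leibniz, rotation_quadric hΓ, smul_zero, add_zero, smul_eq_mul]
  exact dvd_mul_right _ _

lemma derivation_prod {R A ι : Type*} [CommRing R] [CommRing A] [Algebra R A] [DecidableEq ι]
    (δ : Derivation R A A) (s : Finset ι) (f : ι → A) :
    δ (∏ k ∈ s, f k) = ∑ k ∈ s, (∏ j ∈ s.erase k, f j) * δ (f k) := by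
  induction s using Finset.induction_on with
  | empty => simp
  | insert a s ha ih =>
    rw [Finset.prod_insert ha, Derivation.leibniz, ih, Finset.sum_insert ha,
      Finset.erase_insert ha, smul_eq_mul, smul_eq_mul, add_comm, Finset.mul_sum]
    congr 1
    refine Finset.sum_congr rfl fun k hk => ?_
    have hak : a ≠ k := fun h => ha (h ▸ hk)
    rw [Finset.erase_insert_of_ne hak, Finset.prod_insert (fun h => ha (Finset.mem_of_mem_erase h)),
      mul_assoc]

/-- Exchanging the entry `J k` with the extra index `d` is an involution on pairs `(J, d)`. -/
lemma sum_update_swap {p : ℕ} {M : Type*} [AddCommMonoid M] (k : Fin p)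
    (f : (Fin p → Fin 3) → Fin 3 → M) :
    ∑ J, ∑ d, f (Function.update J k d) (J k) = ∑ I, ∑ b, f I b := by
  rw [← Fintype.sum_prod_type', ← Fintype.sum_prod_type']
  refine Finset.sum_nbij' (fun x => (Function.update x.1 k x.2, x.1 k))
    (fun x => (Function.update x.1 k x.2, x.1 k)) ?_ ?_ ?_ ?_ ?_ <;> simp

lemma rotation_polyOf {p : ℕ} (Γ : Fin 3 → Fin 3 → ℝ) (T : Tensor p) :
    rotation Γ (polyOf T)
      = ∑ I, (∑ k, ∑ b, Γ b (I k) * T (Function.update I k b)) • mono I := by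
  rw [polyOf_apply, map_sum]
  simp only [Derivation.map_smul, mono, derivation_prod, rotation_X]
  simp only [Finset.sum_smul, Finset.smul_sum, Finset.mul_sum]
  rw [Finset.sum_comm]
  conv_rhs => rw [Finset.sum_comm]
  refine Finset.sum_congr rfl fun k _ => ?_
  rw [← sum_update_swap k]
  refine Finset.sum_congr rfl fun J _ => Finset.sum_congr rfl fun d _ => ?_
  have := mono_update (Function.update J k d) k (J k)
  rw [mono, Function.update_idem, Function.update_eq_self] at this
  rw [this, Function.update_self, mul_smul_comm, smul_smul, mul_comm (Γ d (J k))]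

namespace FramedMetric

variable (g : FramedMetric)

lemma comm_swap (a b d : Fin 3) (x : Chart) : g.comm a b d x = -g.comm b a d x := by
  rw [comm, comm, VectorField.lieBracket_swap, map_neg, _root_.neg_apply]

/-- Metric compatibility in an orthonormal frame, visible in Koszul's formula from the antisymmetry
of the commutators. -/
lemma conn_swap (a b d : Fin 3) (x : Chart) : g.conn a b d x = -g.conn a d b x := by
  rw [conn, conn, g.comm_swap a b d, g.comm_swap d b a, g.comm_swap d a b]
  ring

lemma polyOf_covD {p : ℕ} (T : Chart → Tensor p) (x : Chart) :
    polyOf (g.covD T x) = ∑ a, MvPolynomial.X a * (polyOf (fderiv ℝ T x (g.c a x))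
      - rotation (fun b d => g.conn a b d x) (polyOf (T x))) := by
  simp only [rotation_polyOf]
  simp only [polyOf_apply, ← Finset.sum_sub_distrib, ← sub_smul, Finset.mul_sum]
  rw [← Fintype.sum_prod_type']
  refine (Fintype.sum_equiv (Fin.consEquiv fun _ => Fin 3) _ _ fun y => ?_).symm
  obtain ⟨a, J⟩ := y
  rw [mono_succ]
  simp [covD, Fin.consEquiv]

lemma symbol_covD {p : ℕ} (T : Chart → Tensor p) (x : Chart) :
    symbol (g.covD T x) = ∑ a, Ideal.Quotient.mk _ (MvPolynomial.X a) *
      (symbol (fderiv ℝ T x (g.c a x)) - Ideal.Quotient.mk _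
        (rotation (fun b d => g.conn a b d x) (polyOf (T x)))) := by
  simp only [symbol_apply, polyOf_covD, map_sum, map_mul, map_sub]

/-! ### Smoothness -/

lemma differentiableAt {E : Type*} [NormedAddCommGroup E] [NormedSpace ℝ E] {T : Chart → E}
    (hT : ContDiffOn ℝ ∞ T g.N) {x : Chart} (hx : x ∈ g.N) : DifferentiableAt ℝ T x :=
  ((hT x hx).contDiffAt (g.isOpen_N.mem_nhds hx)).differentiableAt (by simp)

lemma contDiffOn_fderiv_apply {E : Type*} [NormedAddCommGroup E] [NormedSpace ℝ E]
    {T : Chart → E} {v : Chart → Chart} (hT : ContDiffOn ℝ ∞ T g.N)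
    (hv : ContDiffOn ℝ ∞ v g.N) : ContDiffOn ℝ ∞ (fun x => fderiv ℝ T x (v x)) g.N :=
  (hT.fderiv_of_isOpen g.isOpen_N (by simp)).clm_apply hv

lemma contDiffOn_comm (a b d : Fin 3) : ContDiffOn ℝ ∞ (g.comm a b d) g.N := by
  have : ContDiffOn ℝ ∞ (VectorField.lieBracket ℝ (g.c a) (g.c b)) g.N :=
    (g.contDiffOn_fderiv_apply (g.smooth_c b) (g.smooth_c a)).sub
      (g.contDiffOn_fderiv_apply (g.smooth_c a) (g.smooth_c b))
  exact (g.smooth_h.clm_apply this).clm_apply (g.smooth_c d)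

lemma contDiffOn_conn (a b d : Fin 3) : ContDiffOn ℝ ∞ (g.conn a b d) g.N :=
  contDiffOn_const.mul (((g.contDiffOn_comm a d b).sub (g.contDiffOn_comm d b a)).add
    (g.contDiffOn_comm b a d))

lemma contDiffOn_riem (a b e d : Fin 3) : ContDiffOn ℝ ∞ (g.riem a b e d) g.N :=
  ((g.contDiffOn_fderiv_apply (g.contDiffOn_conn b d e) (g.smooth_c a)).sub
    (g.contDiffOn_fderiv_apply (g.contDiffOn_conn a d e) (g.smooth_c b))).add
    (ContDiffOn.sum fun f _ =>
      (((g.contDiffOn_conn a d f).mul (g.contDiffOn_conn b f e)).sub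
        ((g.contDiffOn_conn b d f).mul (g.contDiffOn_conn a f e))).sub
        ((g.contDiffOn_comm a b f).mul (g.contDiffOn_conn f d e)))

lemma contDiffOn_ricci : ContDiffOn ℝ ∞ g.ricci g.N :=
  by
  refine contDiffOn_euclidean.2 fun I => ?_
  exact ContDiffOn.sum (f := fun a x => g.riem a (I 0) (I 1) a x) (s := univ)
    fun a _ => g.contDiffOn_riem a (I 0) (I 1) a

lemma contDiffOn_covD {p : ℕ} {T : Chart → Tensor p} (hT : ContDiffOn ℝ ∞ T g.N) :
    ContDiffOn ℝ ∞ (g.covD T) g.N := by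
  refine contDiffOn_euclidean.2 fun I => ?_
  refine (contDiffOn_euclidean.1 (g.contDiffOn_fderiv_apply hT (g.smooth_c (I 0))) _).sub ?_
  exact ContDiffOn.sum fun k _ => ContDiffOn.sum fun b _ =>
    (g.contDiffOn_conn _ _ _).mul (contDiffOn_euclidean.1 hT _)

end FramedMetric

lemma contDiffOn_scalar {f : Chart → ℝ} {N : Set Chart} (hf : ContDiffOn ℝ ∞ f N) :
    ContDiffOn ℝ ∞ (fun x => scalar (f x)) N :=
  contDiffOn_euclidean.2 fun _ => hf

lemma contDiffOn_stfPart {p : ℕ} {T : Chart → Tensor p} {N : Set Chart}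
    (hT : ContDiffOn ℝ ∞ T N) : ContDiffOn ℝ ∞ (fun x => stfPart (T x)) N :=
  (stf p).starProjection.contDiff.comp_contDiffOn hT

lemma contDiffOn_tprod {j l p : ℕ} (h : j + l = p) {T : Chart → Tensor j} {U : Chart → Tensor l}
    {N : Set Chart} (hT : ContDiffOn ℝ ∞ T N) (hU : ContDiffOn ℝ ∞ U N) :
    ContDiffOn ℝ ∞ (fun x => tprod h (T x) (U x)) N :=
  contDiffOn_euclidean.2 fun _ => (contDiffOn_euclidean.1 hT _).mul (contDiffOn_euclidean.1 hU _)

namespace FramedMetric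

variable (g : FramedMetric)

/-! ### Symmetrized covariant derivatives -/

lemma symbol_fderiv_congr {p : ℕ} {T U : Chart → Tensor p} (hT : ContDiffOn ℝ ∞ T g.N)
    (hU : ContDiffOn ℝ ∞ U g.N) (h : ∀ x ∈ g.N, symbol (T x) = symbol (U x)) {x : Chart}
    (hx : x ∈ g.N) (v : Chart) : symbol (fderiv ℝ T x v) = symbol (fderiv ℝ U x v) := by
  -- The symbol takes values in a ring without a norm, so the comparison is made through the
  -- continuous linear projector, which commutes with `fderiv`.
  have hev : (fun y => (stf p).starProjection (T y)) =ᶠ[nhds x]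
      fun y => (stf p).starProjection (U y) := by
    filter_upwards [g.isOpen_N.mem_nhds hx] with y hy
    change stfPart (T y) = stfPart (U y)
    refine symbol_injOn (stfPart_mem (T y)) (stfPart_mem (U y)) ?_
    rw [symbol_stfPart, symbol_stfPart, h y hy]
  have key := hev.fderiv_eq (𝕜 := ℝ)
  have hcomp {V : Chart → Tensor p} (hV : ContDiffOn ℝ ∞ V g.N) :
      fderiv ℝ (fun y => (stf p).starProjection (V y)) x
        = (stf p).starProjection.comp (fderiv ℝ V x) :=
    ((stf p).starProjection.hasFDerivAt.comp x (g.differentiableAt hV hx).hasFDerivAt).fderiv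
  rw [hcomp hT, hcomp hU] at key
  have := congrArg symbol (DFunLike.congr_fun key v)
  exact (symbol_stfPart _).symm.trans (this.trans (symbol_stfPart _))

/-- Directional derivatives respect equality of symbols on an open set, and the connection term does
so because the rotations preserve the ideal of the cone. This is what allows projecting, or
reordering indices, before differentiating. -/
lemma symbol_covD_congr {p : ℕ} {T U : Chart → Tensor p} (hT : ContDiffOn ℝ ∞ T g.N)
    (hU : ContDiffOn ℝ ∞ U g.N) (h : ∀ x ∈ g.N, symbol (T x) = symbol (U x)) {x : Chart}
    (hx : x ∈ g.N) : symbol (g.covD T x) = symbol (g.covD U x) := by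
  rw [symbol_covD, symbol_covD]
  refine Finset.sum_congr rfl fun a _ => ?_
  rw [g.symbol_fderiv_congr hT hU h hx]
  congr 2
  rw [Ideal.Quotient.eq, Ideal.mem_span_singleton, ← map_sub]
  refine quadric_dvd_rotation (fun b d => g.conn_swap a b d x) ?_
  rw [← Ideal.mem_span_singleton, ← Ideal.Quotient.eq]
  exact h x hx

lemma covD_add {p : ℕ} {T U : Chart → Tensor p} (hT : ContDiffOn ℝ ∞ T g.N)
    (hU : ContDiffOn ℝ ∞ U g.N) {x : Chart} (hx : x ∈ g.N) :
    g.covD (fun y => T y + U y) x = g.covD T x + g.covD U x := by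
  ext I
  simp only [covD, PiLp.add_apply,
    fderiv_fun_add (g.differentiableAt hT hx) (g.differentiableAt hU hx),
    _root_.add_apply, mul_add, Finset.sum_add_distrib]
  ring

lemma covD_smul {p : ℕ} (r : ℝ) {T : Chart → Tensor p} (hT : ContDiffOn ℝ ∞ T g.N)
    {x : Chart} (hx : x ∈ g.N) : g.covD (fun y => r • T y) x = r • g.covD T x := by
  ext I
  simp only [covD, PiLp.smul_apply, fderiv_fun_const_smul (g.differentiableAt hT hx),
    _root_.smul_apply, smul_eq_mul, mul_sub, Finset.mul_sum]
  simp only [mul_left_comm]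

lemma fderiv_tprod {j l p : ℕ} (h : j + l = p) {T : Chart → Tensor j} {U : Chart → Tensor l}
    (hT : ContDiffOn ℝ ∞ T g.N) (hU : ContDiffOn ℝ ∞ U g.N) {x : Chart} (hx : x ∈ g.N)
    (v : Chart) : fderiv ℝ (fun y => tprod h (T y) (U y)) x v
      = tprod h (fderiv ℝ T x v) (U x) + tprod h (T x) (fderiv ℝ U x v) := by
  have hc {q : ℕ} {V : Chart → Tensor q} (hV : DifferentiableAt ℝ V x) (I : Fin q → Fin 3) :
      HasFDerivAt (fun y => V y I) ((EuclideanSpace.proj I : Tensor q →L[ℝ] ℝ).comp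
        (fderiv ℝ V x)) x :=
    (EuclideanSpace.proj I : Tensor q →L[ℝ] ℝ).hasFDerivAt.comp x hV.hasFDerivAt
  have dT := g.differentiableAt hT hx
  have dU := g.differentiableAt hU hx
  have dP := g.differentiableAt (contDiffOn_tprod h hT hU) hx
  ext I
  have h1 := (hc dP I).unique ((hc dT _).mul (hc dU _))
  have h2 := DFunLike.congr_fun h1 v
  simp only [ContinuousLinearMap.comp_apply, PiLp.proj_apply,
    _root_.add_apply, _root_.smul_apply, smul_eq_mul] at h2
  rw [h2]
  simp only [tprod, PiLp.add_apply]
  ring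

lemma symbol_covD_tprod {j l p : ℕ} (h : j + l = p) {T : Chart → Tensor j}
    {U : Chart → Tensor l} (hT : ContDiffOn ℝ ∞ T g.N) (hU : ContDiffOn ℝ ∞ U g.N)
    {x : Chart} (hx : x ∈ g.N) : symbol (g.covD (fun y => tprod h (T y) (U y)) x)
      = symbol (g.covD T x) * symbol (U x) + symbol (T x) * symbol (g.covD U x) := by
  simp only [symbol_covD, Finset.sum_mul, Finset.mul_sum, ← Finset.sum_add_distrib]
  refine Finset.sum_congr rfl fun a _ => ?_
  rw [g.fderiv_tprod h hT hU hx, map_add, symbol_tprod, symbol_tprod, polyOf_tprod,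
    Derivation.leibniz, map_add, smul_eq_mul, smul_eq_mul, map_mul, map_mul, symbol_apply (T x),
    symbol_apply (U x)]
  ring

/-- The symbol of the `k`-th covariant derivative of a tensor field. -/
def jet : ℕ → ∀ {s : ℕ}, (Chart → Tensor s) → Chart → ConeRing
  | 0, _, T, x => symbol (T x)
  | k + 1, _, T, x => jet k (g.covD T) x

lemma jet_congr (k : ℕ) {s : ℕ} {T U : Chart → Tensor s} (hT : ContDiffOn ℝ ∞ T g.N)
    (hU : ContDiffOn ℝ ∞ U g.N) (h : ∀ x ∈ g.N, symbol (T x) = symbol (U x)) {x : Chart}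
    (hx : x ∈ g.N) : g.jet k T x = g.jet k U x := by
  induction k generalizing s with
  | zero => exact h x hx
  | succ k ih =>
    exact ih (g.contDiffOn_covD hT) (g.contDiffOn_covD hU)
      fun y hy => g.symbol_covD_congr hT hU h hy

lemma jet_add (k : ℕ) {s : ℕ} {T U : Chart → Tensor s} (hT : ContDiffOn ℝ ∞ T g.N)
    (hU : ContDiffOn ℝ ∞ U g.N) {x : Chart} (hx : x ∈ g.N) :
    g.jet k (fun y => T y + U y) x = g.jet k T x + g.jet k U x := by
  induction k generalizing s with
  | zero => exact map_add _ _ _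
  | succ k ih =>
    have hT' := g.contDiffOn_covD hT
    have hU' := g.contDiffOn_covD hU
    -- Additivity of `covD` is known only on `N`, so the fields are exchanged through `jet_congr`
    -- instead of rewriting functions.
    rw [jet, g.jet_congr k (g.contDiffOn_covD (hT.add hU)) (hT'.add hU')
      (fun y hy => by rw [g.covD_add hT hU hy]) hx]
    exact ih hT' hU'

lemma jet_smul (k : ℕ) (r : ℝ) {s : ℕ} {T : Chart → Tensor s} (hT : ContDiffOn ℝ ∞ T g.N)
    {x : Chart} (hx : x ∈ g.N) : g.jet k (fun y => r • T y) x = r • g.jet k T x := by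
  induction k generalizing s with
  | zero => exact map_smul _ _ _
  | succ k ih =>
    have hT' := g.contDiffOn_covD hT
    rw [jet, g.jet_congr k (g.contDiffOn_covD (hT.const_smul r)) (hT'.const_smul r)
      (fun y hy => by rw [g.covD_smul r hT hy]) hx]
    exact ih hT'

/-- The generating series of the symbols of the covariant derivatives of `T` at `x`. -/
def jetSeries {s : ℕ} (T : Chart → Tensor s) (x : Chart) : PowerSeries ConeRing :=
  PowerSeries.mk fun k => ((k.factorial : ℝ)⁻¹) • g.jet k T x

lemma derivative_jetSeries {s : ℕ} (T : Chart → Tensor s) (x : Chart) :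
    PowerSeries.derivative ConeRing (g.jetSeries T x) = g.jetSeries (g.covD T) x := by
  ext k
  rw [PowerSeries.coeff_derivative, jetSeries, jetSeries, PowerSeries.coeff_mk,
    PowerSeries.coeff_mk, jet]
  have : ((k : ConeRing) + 1) = algebraMap ℝ ConeRing (k + 1) := by simp
  rw [this, mul_comm, ← Algebra.smul_def, smul_smul, Nat.factorial_succ]
  congr 1
  push_cast
  field_simp

/-- Both sides satisfy the same Leibniz rule under the formal derivative, so equality of
coefficients goes up by induction on `k` for all pairs of fields at once. -/
lemma jetSeries_tprod {j l p : ℕ} (h : j + l = p) {T : Chart → Tensor j}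
    {U : Chart → Tensor l} (hT : ContDiffOn ℝ ∞ T g.N) (hU : ContDiffOn ℝ ∞ U g.N)
    {x : Chart} (hx : x ∈ g.N) : g.jetSeries (fun y => tprod h (T y) (U y)) x
      = g.jetSeries T x * g.jetSeries U x := by
  ext k
  induction k generalizing j l p with
  | zero =>
    simp only [PowerSeries.coeff_zero_eq_constantCoeff, map_mul]
    simp only [← PowerSeries.coeff_zero_eq_constantCoeff_apply, jetSeries, PowerSeries.coeff_mk,
      jet, symbol_tprod]
    simp
  | succ k ih =>
    have hT' := g.contDiffOn_covD hT
    have hU' := g.contDiffOn_covD hU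
    have h1 : (j + 1) + l = p + 1 := by omega
    have h2 : j + (l + 1) = p + 1 := by omega
    have key : PowerSeries.coeff k (PowerSeries.derivative ConeRing
          (g.jetSeries (fun y => tprod h (T y) (U y)) x))
        = PowerSeries.coeff k (PowerSeries.derivative ConeRing
          (g.jetSeries T x * g.jetSeries U x)) := by
      rw [Derivation.leibniz]
      simp only [derivative_jetSeries, smul_eq_mul, map_add]
      rw [mul_comm (g.jetSeries U x), ← ih h2 hT hU', ← ih h1 hT' hU]
      simp only [jetSeries, PowerSeries.coeff_mk]
      rw [← smul_add, ← g.jet_add k (contDiffOn_tprod h2 hT hU') (contDiffOn_tprod h1 hT' hU) hx]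
      congr 1
      -- The tensor `D(T ⊗ U)` differs from the sum by the position of the derivative index in `T ⊗
      -- D U`; the symbols coincide.
      refine g.jet_congr k (g.contDiffOn_covD (contDiffOn_tprod h hT hU))
        ((contDiffOn_tprod h2 hT hU').add (contDiffOn_tprod h1 hT' hU)) (fun y hy => ?_) hx
      rw [g.symbol_covD_tprod h hT hU hy, map_add, symbol_tprod, symbol_tprod, add_comm]
    rw [PowerSeries.coeff_derivative, PowerSeries.coeff_derivative] at key
    -- The formal derivative brings down `k + 1`, which can be cancelled since `ConeRing` is a real
    -- algebra.
    have hu : IsUnit ((k : ConeRing) + 1) := by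
      have : ((k : ConeRing) + 1) = algebraMap ℝ ConeRing (k + 1) := by simp
      rw [this]
      exact (IsUnit.mk0 _ (by positivity)).map _
    exact hu.mul_right_cancel key

end FramedMetric

namespace FramedMetric

variable (g : FramedMetric)

/-! ### Symmetrized expansions of tensor fields -/

/-- The symmetrized expansion at the origin of a tensor field of valence `s`. -/
def expansion {s : ℕ} (T : Chart → Tensor s) : PowerSeries ConeRing :=
  PowerSeries.X ^ s * g.jetSeries T 0

lemma coeff_expansion {s : ℕ} (T : Chart → Tensor s) (k : ℕ) :
    PowerSeries.coeff (k + s) (g.expansion T) = ((k.factorial : ℝ)⁻¹) • g.jet k T 0 := by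
  rw [expansion, PowerSeries.coeff_X_pow_mul, jetSeries, PowerSeries.coeff_mk]

lemma coeff_expansion_of_lt {s q : ℕ} (T : Chart → Tensor s) (h : q < s) :
    PowerSeries.coeff q (g.expansion T) = 0 := by
  rw [expansion, PowerSeries.coeff_X_pow_mul', if_neg (by omega)]

lemma coeff_expansion_self {s : ℕ} (T : Chart → Tensor s) :
    PowerSeries.coeff s (g.expansion T) = symbol (T 0) := by
  have := g.coeff_expansion T 0
  rw [zero_add] at this
  simp [this, jet]

/-- With `q = k + s + 1`, the `k`-th jet of `D T` is the `(k + 1)`-st jet of `T`, and `1 / k! = (k +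
1) / (k + 1)!` with `k + 1 = q - s`. -/
lemma coeff_expansion_covD {s : ℕ} (T : Chart → Tensor s) (q : ℕ) :
    PowerSeries.coeff q (g.expansion (g.covD T))
      = ((q : ℝ) - s) • PowerSeries.coeff q (g.expansion T) := by
  obtain h | rfl | h := lt_trichotomy q s
  · rw [coeff_expansion_of_lt _ _ h, coeff_expansion_of_lt _ _ (by omega), smul_zero]
  · rw [coeff_expansion_of_lt _ _ (by omega), sub_self, zero_smul]
  · obtain ⟨k, rfl⟩ : ∃ k, q = k + (s + 1) := ⟨q - (s + 1), by omega⟩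
    have e : k + (s + 1) = (k + 1) + s := by omega
    rw [coeff_expansion]
    rw [show PowerSeries.coeff (k + (s + 1)) (g.expansion T)
      = (((k + 1).factorial : ℝ)⁻¹) • g.jet (k + 1) T 0 by rw [e, coeff_expansion]]
    rw [jet, smul_smul, Nat.factorial_succ]
    congr 1
    push_cast
    field_simp
    ring

lemma expansion_congr {s : ℕ} {T U : Chart → Tensor s} (hT : ContDiffOn ℝ ∞ T g.N)
    (hU : ContDiffOn ℝ ∞ U g.N) (h : ∀ x ∈ g.N, symbol (T x) = symbol (U x)) :
    g.expansion T = g.expansion U := by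
  rw [expansion, expansion]
  congr 1
  ext k
  rw [jetSeries, jetSeries, PowerSeries.coeff_mk, PowerSeries.coeff_mk,
    g.jet_congr k hT hU h g.zero_mem_N]

lemma expansion_add {s : ℕ} {T U : Chart → Tensor s} (hT : ContDiffOn ℝ ∞ T g.N)
    (hU : ContDiffOn ℝ ∞ U g.N) :
    g.expansion (fun x => T x + U x) = g.expansion T + g.expansion U := by
  rw [expansion, expansion, expansion, ← mul_add]
  congr 1
  ext k
  simp only [jetSeries, map_add, PowerSeries.coeff_mk, g.jet_add k hT hU g.zero_mem_N, smul_add]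

lemma expansion_smul {s : ℕ} (r : ℝ) {T : Chart → Tensor s} (hT : ContDiffOn ℝ ∞ T g.N) :
    g.expansion (fun x => r • T x) = r • g.expansion T := by
  rw [expansion, expansion, ← mul_smul_comm]
  congr 1
  ext k
  simp only [jetSeries, PowerSeries.coeff_mk, g.jet_smul k r hT g.zero_mem_N,
    PowerSeries.coeff_smul]
  rw [smul_comm]

lemma expansion_sub_smul {s : ℕ} (r : ℝ) {T U : Chart → Tensor s}
    (hT : ContDiffOn ℝ ∞ T g.N) (hU : ContDiffOn ℝ ∞ U g.N) :
    g.expansion (fun x => T x - r • U x) = g.expansion T - r • g.expansion U := by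
  simp only [sub_eq_add_neg, ← neg_smul]
  rw [g.expansion_add hT (hU.const_smul _), g.expansion_smul _ hU]

lemma expansion_tprod {j l p : ℕ} (h : j + l = p) {T : Chart → Tensor j}
    {U : Chart → Tensor l} (hT : ContDiffOn ℝ ∞ T g.N) (hU : ContDiffOn ℝ ∞ U g.N) :
    g.expansion (fun x => tprod h (T x) (U x)) = g.expansion T * g.expansion U := by
  rw [expansion, expansion, expansion, g.jetSeries_tprod h hT hU g.zero_mem_N, ← h, pow_add]
  ring

lemma expansion_stfPart {s : ℕ} {T : Chart → Tensor s} (hT : ContDiffOn ℝ ∞ T g.N) :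
    g.expansion (fun x => stfPart (T x)) = g.expansion T :=
  g.expansion_congr (contDiffOn_stfPart hT) hT fun _ _ => symbol_stfPart _

lemma jet_iterD (f : Chart → ℝ) (x : Chart) (k : ℕ) :
    ∀ m q, k + m = q → g.jet k (g.iterD f m) x = symbol (g.iterD f q x) := by
  induction k with
  | zero => rintro m _ rfl; rw [Nat.zero_add]; rfl
  | succ k ih => exact fun m q h => ih (m + 1) q (by omega)

lemma jet_iterDS (x : Chart) (k : ℕ) :
    ∀ m q, k + m = q → g.jet k (g.iterDS m) x = symbol (g.iterDS q x) := by
  induction k with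
  | zero => rintro m _ rfl; rw [Nat.zero_add]; rfl
  | succ k ih => exact fun m q h => ih (m + 1) q (by omega)

lemma coeff_expansion_scalar (f : Chart → ℝ) (q : ℕ) :
    PowerSeries.coeff q (g.expansion fun x => scalar (f x))
      = ((q.factorial : ℝ)⁻¹) • symbol (g.iterD f q 0) := by
  have := g.coeff_expansion (fun x => scalar (f x)) q
  rw [add_zero] at this
  rw [this, ← g.jet_iterD f 0 q 0 q (by omega)]
  rfl

lemma contDiffOn_iterD {f : Chart → ℝ} (hf : ContDiffOn ℝ ∞ f g.N) (p : ℕ) :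
    ContDiffOn ℝ ∞ (g.iterD f p) g.N := by
  induction p with
  | zero => exact contDiffOn_scalar hf
  | succ p ih => exact g.contDiffOn_covD ih

lemma coeff_expansion_iterD_one (f : Chart → ℝ) (q : ℕ) :
    PowerSeries.coeff q (g.expansion (g.iterD f 1))
      = (q : ℝ) • PowerSeries.coeff q (g.expansion fun x => scalar (f x)) := by
  have := g.coeff_expansion_covD (fun x => scalar (f x)) q
  rwa [Nat.cast_zero, sub_zero] at this

lemma coeff_expansion_iterD_two (f : Chart → ℝ) (q : ℕ) :
    PowerSeries.coeff q (g.expansion (g.iterD f 2))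
      = (((q : ℝ) - 1) * q) • PowerSeries.coeff q (g.expansion fun x => scalar (f x)) := by
  have := g.coeff_expansion_covD (g.iterD f 1) q
  rwa [coeff_expansion_iterD_one, smul_smul, Nat.cast_one] at this

/-! ### Hansen's recursion in terms of expansions -/

lemma contDiffOn_hansenField {f : Chart → ℝ} (hf : ContDiffOn ℝ ∞ f g.N) :
    ∀ s, ContDiffOn ℝ ∞ (g.hansenField f s) g.N
  | 0 => contDiffOn_scalar hf
  | 1 => g.contDiffOn_covD (contDiffOn_scalar hf)
  | s + 2 => contDiffOn_stfPart ((g.contDiffOn_covD (contDiffOn_hansenField hf (s + 1))).sub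
      ((contDiffOn_tprod rfl (contDiffOn_hansenField hf s) g.contDiffOn_ricci).const_smul _))

/-- The projector in each step is invisible to the expansion, so the field recursion and the formal
one agree term by term. -/
lemma expansion_hansenField {f : Chart → ℝ} (hf : ContDiffOn ℝ ∞ f g.N) {S X : SymSeries}
    (hS : g.expansion g.ricci = toSeries S)
    (hX : (g.expansion fun x => scalar (f x)) = toSeries X) :
    ∀ s, g.expansion (g.hansenField f s) = toSeries (hansenSeries S X s)
  | 0 => hX
  | 1 => by
    ext q
    refine (g.coeff_expansion_covD (fun x => scalar (f x)) q).trans ?_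
    rw [hX, coeff_toSeries, coeff_toSeries, hansenSeries, map_smul, Nat.cast_zero, sub_zero]
  | s + 2 => by
    have h1 := g.contDiffOn_hansenField hf (s + 1)
    have h0 := g.contDiffOn_hansenField hf s
    have ht := contDiffOn_tprod (rfl : s + 2 = s + 2) h0 g.contDiffOn_ricci
    have key : g.expansion (g.hansenField f (s + 2))
        = g.expansion (g.covD (g.hansenField f (s + 1)))
          - (1 / 2 * (s + 1) * (2 * (s + 1) - 1) : ℝ) •
            (g.expansion (g.hansenField f s) * g.expansion g.ricci) := by
      rw [← g.expansion_tprod rfl h0 g.contDiffOn_ricci,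
        ← g.expansion_sub_smul _ (g.contDiffOn_covD h1) ht]
      exact g.expansion_stfPart ((g.contDiffOn_covD h1).sub (ht.const_smul _))
    ext q
    rw [key, expansion_hansenField hf hS hX s, hS, ← toSeries_symMul, map_sub,
      coeff_expansion_covD, expansion_hansenField hf hS hX (s + 1), PowerSeries.coeff_smul,
      coeff_toSeries, coeff_toSeries, coeff_toSeries, hansenSeries, map_sub, map_smul, map_smul]
    push_cast
    rfl

lemma hansenField_mem (f : Chart → ℝ) : ∀ s x, g.hansenField f s x ∈ stf s
  | 0, _ => scalar_mem _
  | 1, x => by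
    refine ⟨fun σ I => ?_, fun i j hij => (hij (Subsingleton.elim i j)).elim⟩
    rw [Subsingleton.elim σ 1]
    rfl
  | _ + 2, _ => stfPart_mem _

lemma hansenSeries_eq_hansenField {f : Chart → ℝ} (hf : ContDiffOn ℝ ∞ f g.N) {S X : SymSeries}
    (hS : g.expansion g.ricci = toSeries S)
    (hX : (g.expansion fun x => scalar (f x)) = toSeries X) (hXm : ∀ q, X q ∈ stf q) (p : ℕ) :
    hansenSeries S X p p = g.hansenField f p 0 := by
  refine symbol_injOn (hansenSeries_mem S X hXm p p) (g.hansenField_mem f p 0) ?_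
  rw [← coeff_toSeries, ← g.expansion_hansenField hf hS hX, coeff_expansion_self]

end FramedMetric

lemma symbol_smul {p : ℕ} (r : ℝ) (T : Tensor p) :
    symbol (r • T) = algebraMap ℝ ConeRing r * symbol T := by
  rw [map_smul]
  exact Algebra.smul_def r (symbol T)

/-! ### The expansion of the mass potential -/

lemma symbol_phiMSeries_succ (D : NullData) (q : ℕ) :
    symbol (D.phiMSeries (q + 1)) = (-(1 / 2) : ℝ) •
      (symbol (symMul D.phiSeries D.phiSeries (q + 1))
        + ∑ j ∈ Finset.range q, symbol (D.phiMSeries (j + 1)) * symbol (D.phiMSeries (q - j))) := by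
  rw [NullData.phiMSeries, ← neg_smul, map_smul, map_add, map_sum,
    ← Fin.sum_univ_eq_sum_range (fun j =>
      symbol (D.phiMSeries (j + 1)) * symbol (D.phiMSeries (q - j))) q]
  simp only [symbol_symProd]

lemma symbol_phiMSeries_zero (D : NullData) : symbol (D.phiMSeries 0) = 1 := by
  rw [NullData.phiMSeries, symbol_scalar, map_one]

lemma symbol_phiSeries_zero (D : NullData) : symbol (D.phiSeries 0) = 0 := by
  rw [NullData.phiSeries, D.psi_zero, smul_zero, map_zero]

/-- The recursion for `phiMSeries` solves this equation valence by valence: the two end terms of the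
square are both the unknown, because the valence-`0` part is `1`. -/
lemma phiMSeries_sq (D : NullData) :
    toSeries D.phiMSeries * toSeries D.phiMSeries
      = 1 - toSeries D.phiSeries * toSeries D.phiSeries := by
  have h0 := symbol_phiMSeries_zero D
  have hphi := symbol_phiSeries_zero D
  ext q
  rw [← toSeries_symMul, ← toSeries_symMul, map_sub, coeff_toSeries, coeff_toSeries]
  cases q with
  | zero =>
    rw [symbol_symMul, symbol_symMul]
    simp [h0, hphi]
  | succ q =>
    have hrec := symbol_phiMSeries_succ D q
    rw [symbol_symMul, Finset.Nat.sum_antidiagonal_eq_sum_range_succ_mk, Finset.sum_range_succ,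
      Finset.sum_range_succ', PowerSeries.coeff_one, if_neg (Nat.succ_ne_zero q)]
    obtain ⟨m, hm⟩ : ∃ m : ℕ → ConeRing, ∀ q, symbol (D.phiMSeries q) = m q := ⟨_, fun _ => rfl⟩
    simp only [hm] at hrec h0 ⊢
    simp only [Nat.add_sub_add_right, Nat.sub_self, Nat.sub_zero, h0, one_mul, mul_one]
    have h2 : m (q + 1) + m (q + 1) = -(symbol (symMul D.phiSeries D.phiSeries (q + 1))
        + ∑ j ∈ Finset.range q, m (j + 1) * m (q - j)) := by
      rw [hrec, ← add_smul]
      norm_num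
      ring
    linear_combination h2

/-- The factor `X + Y` of `X² - Y²` has constant coefficient `2`, hence is a unit. -/
lemma eq_of_sq_eq_of_constantCoeff_eq_one {X Y : PowerSeries ConeRing} (h : X * X = Y * Y)
    (hX : PowerSeries.constantCoeff X = 1) (hY : PowerSeries.constantCoeff Y = 1) : X = Y := by
  have hu : IsUnit (X + Y) := by
    rw [PowerSeries.isUnit_iff_constantCoeff, map_add, hX, hY, one_add_one_eq_two]
    have : (2 : ConeRing) = algebraMap ℝ ConeRing 2 := (map_ofNat _ 2).symm
    rw [this]
    exact (IsUnit.mk0 (2 : ℝ) (by norm_num)).map _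
  have : (X - Y) * (X + Y) = 0 * (X + Y) := by linear_combination h
  exact sub_eq_zero.1 (hu.mul_right_cancel this)

/-! ### Expansions of conformal stationary fields -/

namespace StationaryFields

variable (F : StationaryFields)

lemma expansion_phiS :
    (F.expansion fun x => scalar (F.phiS x)) = toSeries F.nullData.phiSeries := by
  ext q
  rw [FramedMetric.coeff_expansion_scalar, coeff_toSeries, NullData.phiSeries, map_smul]
  congr 1
  exact (symbol_stfPart _).symm

lemma expansion_ricci : F.expansion F.ricci = toSeries F.nullData.ricciSeries := by
  rw [← F.expansion_stfPart F.contDiffOn_ricci]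
  ext q
  rw [coeff_toSeries, NullData.ricciSeries, map_smul]
  match q with
  | 0 => rw [F.nullData.Psi_zero, map_zero, smul_zero, F.coeff_expansion_of_lt _ (by omega)]
  | 1 => rw [F.nullData.Psi_one, map_zero, smul_zero, F.coeff_expansion_of_lt _ (by omega)]
  | q + 2 =>
    -- The valence is two more than the number of derivatives, which accounts for `(q - 2)!` in
    -- `ricciSeries`.
    rw [FramedMetric.coeff_expansion, Nat.add_sub_cancel]
    congr 1
    exact (F.jet_iterDS 0 q 0 q (by omega)).trans (symbol_stfPart _).symm

lemma contDiffOn_Omega : ContDiffOn ℝ ∞ F.Omega F.N :=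
  (((F.smooth_phiM.pow 2).add (F.smooth_phiS.pow 2)).sub contDiffOn_const).congr
    fun x _ => F.Omega_eq x

/-- The trace free part of the field equation, for expansions. -/
lemma expansion_field_eq : F.expansion (F.iterD F.Omega 2) =
    (-1 : ℝ) • ((F.expansion fun x => scalar (F.Omega x)) * F.expansion F.ricci)
      + ((-1 / 2 : ℝ) • ((F.expansion fun x => scalar (F.Omega x))
          * (F.expansion (F.iterD F.Omega 1) * F.expansion (F.iterD F.Omega 1)))
      + ((1 / 2 : ℝ) • (F.expansion (F.iterD F.Omega 1) * F.expansion (F.iterD F.Omega 1))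
      + (2 : ℝ) • ((F.expansion fun x => scalar (F.Omega x))
          * ((F.expansion fun x => scalar (F.Omega x))
          * (F.expansion (F.iterD F.phiM 1) * F.expansion (F.iterD F.phiM 1)
            + F.expansion (F.iterD F.phiS 1) * F.expansion (F.iterD F.phiS 1)))))) := by
  have hO := contDiffOn_scalar F.contDiffOn_Omega
  have h1 := F.contDiffOn_iterD F.contDiffOn_Omega 1
  have hM := F.contDiffOn_iterD F.smooth_phiM 1
  have hS := F.contDiffOn_iterD F.smooth_phiS 1
  have e2 : 1 + 1 = 2 := rfl
  have e0 : 0 + 2 = 2 := rfl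
  have h11 := contDiffOn_tprod e2 h1 h1
  have hMM := contDiffOn_tprod e2 hM hM
  have hSS := contDiffOn_tprod e2 hS hS
  have hMS := hMM.add hSS
  have hR := contDiffOn_tprod e0 hO F.contDiffOn_ricci
  have hO11 := contDiffOn_tprod e0 hO h11
  have hOMS := contDiffOn_tprod e0 hO hMS
  have hOOMS := contDiffOn_tprod e0 hO hOMS
  rw [← F.expansion_tprod e2 h1 h1, ← F.expansion_tprod e2 hM hM, ← F.expansion_tprod e2 hS hS,
    ← F.expansion_add hMM hSS, ← F.expansion_tprod e0 hO hMS, ← F.expansion_tprod e0 hO hOMS,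
    ← F.expansion_tprod e0 hO h11, ← F.expansion_tprod e0 hO F.contDiffOn_ricci,
    ← F.expansion_smul _ hR, ← F.expansion_smul _ hO11, ← F.expansion_smul _ h11,
    ← F.expansion_smul _ hOOMS, ← F.expansion_add (h11.const_smul _) (hOOMS.const_smul _),
    ← F.expansion_add (hO11.const_smul _) ((h11.const_smul _).add (hOOMS.const_smul _)),
    ← F.expansion_add (hR.const_smul _)
      ((hO11.const_smul _).add ((h11.const_smul _).add (hOOMS.const_smul _)))]
  refine F.expansion_congr (F.contDiffOn_iterD F.contDiffOn_Omega 2) ((hR.const_smul _).add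
    ((hO11.const_smul _).add ((h11.const_smul _).add (hOOMS.const_smul _)))) fun x hx => ?_
  rw [← symbol_stfPart, F.field_eq x hx, symbol_stfPart]
  simp only [map_add, map_sub, map_neg, symbol_smul, symbol_tprod, symbol_scalar,
    map_mul, map_pow, map_one, map_ofNat, neg_div]
  ring

/-- All the symmetrized derivatives of `Ω` vanish at `i`. -/
lemma expansion_Omega : (F.expansion fun x => scalar (F.Omega x)) = 0 := by
  have hS : PowerSeries.X ^ 2 ∣ F.expansion F.ricci := ⟨_, rfl⟩
  have h1 (q : ℕ) := F.coeff_expansion_iterD_one F.Omega q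
  have h2 (q : ℕ) := F.coeff_expansion_iterD_two F.Omega q
  have hc0 : PowerSeries.coeff 0 (F.expansion fun x => scalar (F.Omega x)) = 0 := by
    rw [FramedMetric.coeff_expansion_self, symbol_scalar, F.Omega_eq, F.phiM_zero, F.phiS_zero]
    norm_num
  have hc1 : PowerSeries.coeff 1 (F.expansion fun x => scalar (F.Omega x)) = 0 := by
    rw [FramedMetric.coeff_expansion_scalar, F.D_Omega, map_zero, smul_zero]
  have heq := F.expansion_field_eq
  generalize (F.expansion fun x => scalar (F.Omega x)) = w at *
  generalize F.expansion (F.iterD F.Omega 1) = v at *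
  generalize F.expansion F.ricci = R at *
  generalize F.expansion (F.iterD F.phiM 1) * F.expansion (F.iterD F.phiM 1)
    + F.expansion (F.iterD F.phiS 1) * F.expansion (F.iterD F.phiS 1) = Y at heq
  ext q
  rw [map_zero]
  induction q using Nat.strong_induction_on with
  | _ q ih =>
  obtain rfl | rfl | hq : q = 0 ∨ q = 1 ∨ 2 ≤ q := by omega
  · exact hc0
  · exact hc1
  -- By induction `w` and `v` start at order `q`. Each term on the right then starts at order `q +
  -- 2` or at least `2q`, beyond `q`, while the left side has coefficient `(q - 1) q w_q`.
  have hw : PowerSeries.X ^ q ∣ w := PowerSeries.X_pow_dvd_iff.2 ih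
  have hv : PowerSeries.X ^ q ∣ v := PowerSeries.X_pow_dvd_iff.2 fun m hm => by
    rw [h1, ih m hm, smul_zero]
  have aux {n : ℕ} {Z : PowerSeries ConeRing} (hn : q + 1 ≤ n) (hZ : PowerSeries.X ^ n ∣ Z) :
      PowerSeries.coeff q Z = 0 := PowerSeries.X_pow_dvd_iff.1 hZ q (by omega)
  have a1 := aux (n := q + 2) (by omega)
    (pow_add (PowerSeries.X (R := ConeRing)) q 2 ▸ mul_dvd_mul hw hS)
  have hvv : PowerSeries.X ^ (q + q) ∣ v * v :=
    pow_add (PowerSeries.X (R := ConeRing)) q q ▸ mul_dvd_mul hv hv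
  have a2 := aux (by omega) (hvv.mul_left w)
  have a3 := aux (by omega) hvv
  have a4 : PowerSeries.coeff q (w * (w * Y)) = 0 := by
    rw [← mul_assoc]
    exact aux (n := q + q) (by omega)
      ((pow_add (PowerSeries.X (R := ConeRing)) q q ▸ mul_dvd_mul hw hw :
        PowerSeries.X ^ (q + q) ∣ w * w).mul_right Y)
  have key := h2 q
  rw [heq] at key
  simp only [map_add, PowerSeries.coeff_smul, a1, a2, a3, a4, smul_zero, add_zero] at key
  have hq' : (2 : ℝ) ≤ q := by exact_mod_cast hq
  have hne : ((q : ℝ) - 1) * q ≠ 0 := mul_ne_zero (by linarith) (by linarith)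
  exact (smul_eq_zero_iff_right hne).1 key.symm

lemma expansion_phiM :
    (F.expansion fun x => scalar (F.phiM x)) = toSeries F.nullData.phiMSeries := by
  have hM := contDiffOn_scalar F.smooth_phiM
  have hS := contDiffOn_scalar F.smooth_phiS
  have h1 := contDiffOn_scalar (contDiffOn_const (c := (1 : ℝ)) (s := F.N) (n := ∞))
  have e0 : 0 + 0 = 0 := rfl
  refine eq_of_sq_eq_of_constantCoeff_eq_one ?_ ?_ ?_
  · rw [phiMSeries_sq, ← expansion_phiS]
    have h := F.expansion_Omega
    -- The expansion of the constant `1` is idempotent and has constant coefficient `1`; an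
    -- idempotent unit equals `1`.
    have hone : (F.expansion fun _ => scalar 1) = 1 := by
      have h11 := F.expansion_tprod e0 h1 h1
      rw [F.expansion_congr (U := fun _ => scalar 1) (contDiffOn_tprod e0 h1 h1) h1
        (fun x _ => by rw [symbol_tprod, symbol_scalar, map_one, mul_one])] at h11
      have hu : IsUnit (F.expansion fun _ => scalar 1) := by
        rw [PowerSeries.isUnit_iff_constantCoeff,
          ← PowerSeries.coeff_zero_eq_constantCoeff_apply, FramedMetric.coeff_expansion_self,
          symbol_scalar, map_one]
        exact isUnit_one
      exact hu.mul_right_cancel (by rw [one_mul, ← h11])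
    have key : (F.expansion fun x => scalar (F.Omega x))
        = F.expansion fun x => tprod e0 (scalar (F.phiM x)) (scalar (F.phiM x))
          + (tprod e0 (scalar (F.phiS x)) (scalar (F.phiS x)) + (-1 : ℝ) • scalar 1) :=
      F.expansion_congr (contDiffOn_scalar F.contDiffOn_Omega) ((contDiffOn_tprod e0 hM hM).add
        ((contDiffOn_tprod e0 hS hS).add (h1.const_smul _))) fun x _ => by
        simp only [map_add, symbol_smul, symbol_tprod, symbol_scalar, F.Omega_eq, map_sub,
          map_pow, map_one, map_neg]
        ring
    rw [h, F.expansion_add (contDiffOn_tprod e0 hM hM)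
      ((contDiffOn_tprod e0 hS hS).add (h1.const_smul _)),
      F.expansion_add (contDiffOn_tprod e0 hS hS) (h1.const_smul _), F.expansion_smul _ h1,
      F.expansion_tprod e0 hM hM, F.expansion_tprod e0 hS hS, hone, neg_smul, one_smul] at key
    linear_combination -key
  · rw [← PowerSeries.coeff_zero_eq_constantCoeff_apply, FramedMetric.coeff_expansion_self,
      symbol_scalar, F.phiM_zero, map_one]
  · rw [← PowerSeries.coeff_zero_eq_constantCoeff_apply, coeff_toSeries, NullData.phiMSeries,
      symbol_scalar, map_one]

/-- `Θ` maps the null data of conformal stationary fields to their Hansen multipoles. -/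
theorem Theta_nullData (p : ℕ) :
    (Theta F.nullData).nuM p = F.hansenField F.phiM p 0 ∧
    (Theta F.nullData).nuS p = F.hansenField F.phiS p 0 :=
  ⟨F.hansenSeries_eq_hansenField F.smooth_phiM F.expansion_ricci F.expansion_phiM
    (phiMSeries_mem _) p,
  F.hansenSeries_eq_hansenField F.smooth_phiS F.expansion_ricci F.expansion_phiS
    (phiSeries_mem _) p⟩

end StationaryFields

/-! ### Symmetrized polynomial expressions in the null data -/

namespace IsSymCombination

lemma mem_stf {a b p : ℕ} {f : NullData → Tensor p} (hf : IsSymCombination a b p f)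
    (D : NullData) : f D ∈ stf p := by
  induction hf with
  | psi q _ _ => exact D.psi_mem q
  | Psi q _ _ => exact D.Psi_mem q
  | zero p => exact (stf p).zero_mem
  | add _ _ h1 h2 => exact (stf _).add_mem h1 h2
  | smul r _ h => exact (stf _).smul_mem r h
  | mul h _ _ _ _ => exact symProd_mem h _ _

lemma mono {a b a' b' p : ℕ} (ha : a ≤ a') (hb : b ≤ b') {f : NullData → Tensor p}
    (hf : IsSymCombination a b p f) : IsSymCombination a' b' p f := by
  induction hf with
  | psi q h1 h2 => exact .psi q h1 (h2.trans ha)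
  | Psi q h1 h2 => exact .Psi q h1 (h2.trans hb)
  | zero p => exact .zero p
  | add _ _ h1 h2 => exact .add h1 h2
  | smul r _ h => exact .smul r h
  | mul h _ _ h1 h2 => exact .mul h h1 h2

lemma congr {a b p : ℕ} {f : NullData → Tensor p} (hf : IsSymCombination a b p f)
    {D D' : NullData} (h1 : ∀ q ≤ a, D.psi q = D'.psi q) (h2 : ∀ q ≤ b, D.Psi q = D'.Psi q) :
    f D = f D' := by
  induction hf with
  | psi q _ h => exact h1 q h
  | Psi q _ h => exact h2 q h
  | zero p => rfl
  | add _ _ h h' => simp only [h, h']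
  | smul r _ h => simp only [h]
  | mul e _ _ h h' => simp only [h, h']

lemma eq_zero {p : ℕ} {f : NullData → Tensor p} (hf : IsSymCombination 0 1 p f)
    (D : NullData) : f D = 0 := by
  induction hf with
  | psi q h h' => omega
  | Psi q h h' => omega
  | zero p => rfl
  | add _ _ h h' => simp only [h, h', add_zero]
  | smul r _ h => simp only [h, smul_zero]
  | mul e _ _ h h' =>
    simp only [h, h']
    refine eq_zero_of_symbol_eq_zero (symProd_mem e _ _) ?_
    rw [symbol_symProd, map_zero, zero_mul]

end IsSymCombination

/-- Functions of the null data that are symbols of symmetrized polynomial expressions. -/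
def IsSymbolCombination (a b p : ℕ) (F : NullData → ConeRing) : Prop :=
  ∃ f : NullData → Tensor p, IsSymCombination a b p f ∧ ∀ D, F D = symbol (f D)

namespace IsSymbolCombination

variable {a b p : ℕ} {F G : NullData → ConeRing}

lemma mono {a' b' : ℕ} (hF : IsSymbolCombination a b p F) (ha : a ≤ a') (hb : b ≤ b') :
    IsSymbolCombination a' b' p F := by
  obtain ⟨f, hf, h⟩ := hF
  exact ⟨f, hf.mono ha hb, h⟩

lemma congr (hF : IsSymbolCombination a b p F) (h : ∀ D, G D = F D) :
    IsSymbolCombination a b p G := by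
  rwa [funext h]

lemma zero : IsSymbolCombination a b p fun _ => 0 :=
  ⟨_, .zero p, fun _ => (map_zero _).symm⟩

lemma add (hF : IsSymbolCombination a b p F) (hG : IsSymbolCombination a b p G) :
    IsSymbolCombination a b p fun D => F D + G D := by
  obtain ⟨f, hf, h⟩ := hF
  obtain ⟨f', hf', h'⟩ := hG
  exact ⟨_, hf.add hf', fun D => by simp only [map_add, h, h']⟩

lemma smul (r : ℝ) (hF : IsSymbolCombination a b p F) :
    IsSymbolCombination a b p fun D => r • F D := by
  obtain ⟨f, hf, h⟩ := hF
  exact ⟨_, hf.smul r, fun D => by simp only [map_smul, h]⟩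

lemma sub (hF : IsSymbolCombination a b p F) (hG : IsSymbolCombination a b p G) :
    IsSymbolCombination a b p fun D => F D - G D :=
  (hF.add (hG.smul (-1))).congr fun D => by rw [neg_smul, one_smul, sub_eq_add_neg]

lemma mul {j l : ℕ} (h : j + l = p) (hF : IsSymbolCombination a b j F)
    (hG : IsSymbolCombination a b l G) : IsSymbolCombination a b p fun D => F D * G D := by
  obtain ⟨f, hf, h1⟩ := hF
  obtain ⟨f', hf', h1'⟩ := hG
  exact ⟨_, .mul h hf hf', fun D => by simp only [symbol_symProd, h1, h1']⟩

lemma sum {ι : Type*} (s : Finset ι) {F : ι → NullData → ConeRing}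
    (hF : ∀ i ∈ s, IsSymbolCombination a b p (F i)) :
    IsSymbolCombination a b p fun D => ∑ i ∈ s, F i D := by
  classical
  induction s using Finset.induction_on with
  | empty => exact zero.congr fun D => Finset.sum_empty
  | insert i s hi ih =>
    exact ((hF i (Finset.mem_insert_self i s)).add
      (ih fun k hk => hF k (Finset.mem_insert_of_mem hk))).congr fun D => Finset.sum_insert hi

end IsSymbolCombination

lemma symbol_phiSeries (D : NullData) (q : ℕ) :
    symbol (D.phiSeries q) = ((q.factorial : ℝ)⁻¹) • symbol (D.psi q) := map_smul _ _ _

lemma symbol_ricciSeries (D : NullData) (q : ℕ) :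
    symbol (D.ricciSeries q) = (((q - 2).factorial : ℝ)⁻¹) • symbol (D.Psi q) := map_smul _ _ _

lemma symbol_ricciSeries_of_lt (D : NullData) {q : ℕ} (h : q < 2) :
    symbol (D.ricciSeries q) = 0 := by
  obtain rfl | rfl : q = 0 ∨ q = 1 := by omega
  · rw [symbol_ricciSeries, D.Psi_zero, map_zero, smul_zero]
  · rw [symbol_ricciSeries, D.Psi_one, map_zero, smul_zero]

lemma isSymbolCombination_phiSeries {a b q : ℕ} (h : q ≤ a) :
    IsSymbolCombination a b q fun D => symbol (D.phiSeries q) := by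
  obtain rfl | hq := Nat.eq_zero_or_pos q
  · exact IsSymbolCombination.zero.congr symbol_phiSeries_zero
  · exact ⟨_, (IsSymCombination.psi q hq h).smul _, fun D => rfl⟩

lemma isSymbolCombination_ricciSeries {a b q : ℕ} (h : q ≤ b) :
    IsSymbolCombination a b q fun D => symbol (D.ricciSeries q) := by
  obtain hq | hq := Nat.lt_or_ge q 2
  · exact IsSymbolCombination.zero.congr fun D => symbol_ricciSeries_of_lt D hq
  · exact ⟨_, (IsSymCombination.Psi q hq h).smul _, fun D => rfl⟩

/-! ### The structure of the expansion of the mass potential -/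

/-- Since `φ` has no valence-`0` part, both factors of each product in the recursion have valence at
most `q`. -/
lemma isSymbolCombination_phiMSeries (q : ℕ) :
    IsSymbolCombination q 0 (q + 1) fun D => symbol (D.phiMSeries (q + 1)) := by
  induction q using Nat.strong_induction_on with
  | _ q ih =>
  refine IsSymbolCombination.congr (.smul (-(1 / 2)) (.add (.sum _ fun x hx => ?_)
    (.sum (Finset.range q) fun j hj => ?_))) fun D => (symbol_phiMSeries_succ D q).trans
    (by rw [symbol_symMul])
  · have hx' := mem_antidiagonal.1 hx
    by_cases h1 : x.1 = 0
    · exact IsSymbolCombination.zero.congr fun D => by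
        rw [h1, symbol_phiSeries_zero, zero_mul]
    by_cases h2 : x.2 = 0
    · exact IsSymbolCombination.zero.congr fun D => by
        rw [h2, symbol_phiSeries_zero, mul_zero]
    exact .mul hx' (isSymbolCombination_phiSeries (by omega))
      (isSymbolCombination_phiSeries (by omega))
  · have hj' := Finset.mem_range.1 hj
    obtain ⟨k, hk⟩ : ∃ k, q - j = k + 1 := ⟨q - j - 1, by omega⟩
    rw [hk]
    exact .mul (by omega) ((ih j hj').mono hj'.le le_rfl)
      ((ih k (by omega)).mono (by omega) le_rfl)

lemma sum_antidiagonal_add_three {R : Type*} [CommRing R] {f : ℕ → R} (h : f 0 = 0) (r : ℕ) :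
    ∑ x ∈ antidiagonal (r + 3), f x.1 * f x.2 = ∑ i ∈ Finset.range r, f (i + 2) * f (r - i + 1)
      + (f 1 * f (r + 2) + f 1 * f (r + 2)) := by
  rw [Finset.Nat.sum_antidiagonal_eq_sum_range_succ_mk, Finset.sum_range_succ',
    Finset.sum_range_succ', Finset.sum_range_succ, Finset.sum_range_succ]
  have e1 : r + 3 - (r + 1 + 1) = 1 := by omega
  have e2 : r + 3 - (0 + 1) = r + 2 := by omega
  have e3 : r + 3 - (r + 1 + 1 + 1) = 0 := by omega
  rw [Finset.sum_congr rfl (g := fun i => f (i + 2) * f (r - i + 1)) fun i hi => by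
    have : r + 3 - (i + 1 + 1) = r - i + 1 := by have := Finset.mem_range.1 hi; omega
    rw [this]]
  dsimp only
  rw [e1, e2, e3, h]
  ring

/-- In `φ ⊙ φ` the top factor `φ_{r+2}` occurs twice, paired with `φ_1`; the prefactor `-1/2` turns
this into `-φ_1 φ_{r+2}`. The products of `φ_M` parts have valences at most `r + 2`, hence contain
no `ψ` beyond `r + 1`. -/
lemma isSymbolCombination_phiMSeries_add (r : ℕ) :
    IsSymbolCombination (r + 1) 0 (r + 3) fun D => symbol (D.phiMSeries (r + 3))
      + symbol (D.phiSeries 1) * symbol (D.phiSeries (r + 2)) := by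
  refine IsSymbolCombination.congr (.smul (-(1 / 2))
    (.add (.sum (Finset.range r) (F := fun i D =>
        symbol (D.phiSeries (i + 2)) * symbol (D.phiSeries (r - i + 1))) fun i hi => ?_)
    (.sum (Finset.range (r + 2)) (F := fun j D =>
        symbol (D.phiMSeries (j + 1)) * symbol (D.phiMSeries (r + 2 - j)))
      fun j hj => ?_))) fun D => ?_
  · have hi' := Finset.mem_range.1 hi
    exact .mul (by omega) (isSymbolCombination_phiSeries (by omega))
      (isSymbolCombination_phiSeries (by omega))
  · have hj' := Finset.mem_range.1 hj
    obtain ⟨k, hk⟩ : ∃ k, r + 2 - j = k + 1 := ⟨r + 2 - j - 1, by omega⟩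
    rw [hk]
    exact .mul (by omega) ((isSymbolCombination_phiMSeries j).mono (by omega) le_rfl)
      ((isSymbolCombination_phiMSeries k).mono (by omega) le_rfl)
  · rw [symbol_phiMSeries_succ D (r + 2), symbol_symMul,
      sum_antidiagonal_add_three (f := fun q => symbol (D.phiSeries q)) (symbol_phiSeries_zero D)]
    module

/-! ### The structure of Hansen's recursion -/

lemma symbol_hansenSeries_zero (S X : SymSeries) (q : ℕ) :
    symbol (hansenSeries S X 0 q) = symbol (X q) := by
  rw [hansenSeries]

lemma symbol_hansenSeries_one (S X : SymSeries) (q : ℕ) :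
    symbol (hansenSeries S X 1 q) = (q : ℝ) • symbol (X q) := by
  rw [hansenSeries, map_smul]

lemma symbol_hansenSeries_add_two (S X : SymSeries) (s q : ℕ) :
    symbol (hansenSeries S X (s + 2) q)
      = ((q : ℝ) - (s + 1)) • symbol (hansenSeries S X (s + 1) q)
        - (1 / 2 * (s + 1) * (2 * (s + 1) - 1) : ℝ) •
          ∑ x ∈ antidiagonal q, symbol (hansenSeries S X s x.1) * symbol (S x.2) := by
  rw [hansenSeries, map_sub, map_smul, map_smul, symbol_symMul]

/-- The first derivative removes the monopole, and products with `S` do not restore it. So the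
monopole multiplies `S` only in the step producing `P_2`. -/
lemma symbol_hansenSeries_succ_zero {S : SymSeries} (hS : symbol (S 0) = 0) (X : SymSeries)
    (s : ℕ) : symbol (hansenSeries S X (s + 1) 0) = 0 := by
  induction s with
  | zero => rw [symbol_hansenSeries_one, Nat.cast_zero, zero_smul]
  | succ s ih =>
    rw [symbol_hansenSeries_add_two, ih, smul_zero, Finset.Nat.antidiagonal_zero,
      Finset.sum_singleton, hS, mul_zero, smul_zero, sub_zero]

/-- The coefficient of the `q`-th term of the potential in the `q`-th term of `P_s`. -/
def potentialCoeff (s : ℕ) (x : ℝ) : ℝ := ∏ i ∈ Finset.range s, (x - i)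

/-- The coefficient of the `q`-th term of the Ricci tensor in the `q`-th term of `P^M_s`. -/
def ricciCoeff : ℕ → ℝ → ℝ
  | 0, _ => 0
  | 1, _ => 0
  | s + 2, x => -(1 / 2) * ∏ i ∈ Finset.range s, (x - 2 - i)

lemma potentialCoeff_self (p : ℕ) : potentialCoeff p p = p.factorial := by
  rw [potentialCoeff, ← Nat.descFactorial_self, Nat.descFactorial_eq_prod_range, Nat.cast_prod]
  exact Finset.prod_congr rfl fun i hi => (Nat.cast_sub (Finset.mem_range.1 hi).le).symm

lemma ricciCoeff_self (p : ℕ) : ricciCoeff (p + 2) ((p + 2 : ℕ) : ℝ) = -(1 / 2) * p.factorial := by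
  rw [← potentialCoeff_self, ricciCoeff, potentialCoeff]
  push_cast
  simp only [add_sub_cancel_right]

/-- The product terms in Hansen's recursion, apart from the one with the monopole. -/
lemma isSymbolCombination_mul_ricciSeries {i j q : ℕ} {H : NullData → ConeRing}
    (h : i + j = q) (hi : 1 ≤ i) (hH : 2 ≤ j → IsSymbolCombination i i i H) :
    IsSymbolCombination (q - 2) (q - 1) q fun D => H D * symbol (D.ricciSeries j) := by
  obtain hj | hj := Nat.lt_or_ge j 2
  · exact IsSymbolCombination.zero.congr fun D => by
      rw [symbol_ricciSeries_of_lt D hj, mul_zero]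
  · exact .mul h ((hH hj).mono (by omega) (by omega))
      (isSymbolCombination_ricciSeries (by omega))

/-- The derivative steps build up `potentialCoeff`. In the products the valence-`0` factor vanishes,
as `φ` has no monopole, so the remaining factors have lower valence. -/
lemma isSymbolCombination_hansenSeries_phiSeries : ∀ s q : ℕ,
    IsSymbolCombination (q - 2) (q - 1) q fun D =>
      symbol (hansenSeries D.ricciSeries D.phiSeries s q)
        - potentialCoeff s q • symbol (D.phiSeries q)
  | 0, q => IsSymbolCombination.zero.congr fun D => by
      simp [symbol_hansenSeries_zero, potentialCoeff]
  | 1, q => IsSymbolCombination.zero.congr fun D => by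
      simp [symbol_hansenSeries_one, potentialCoeff]
  | s + 2, q => by
    refine IsSymbolCombination.congr (.sub
      ((isSymbolCombination_hansenSeries_phiSeries (s + 1) q).smul ((q : ℝ) - (s + 1)))
      (.smul (1 / 2 * (s + 1) * (2 * (s + 1) - 1) : ℝ) (.sum (antidiagonal q)
        (F := fun x D => symbol (hansenSeries D.ricciSeries D.phiSeries s x.1)
          * symbol (D.ricciSeries x.2)) fun x hx => ?_))) fun D => ?_
    · have hx' := mem_antidiagonal.1 hx
      obtain h0 | h0 := Nat.eq_zero_or_pos x.1
      · refine IsSymbolCombination.zero.congr fun D => ?_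
        rw [h0]
        cases s with
        | zero => rw [symbol_hansenSeries_zero, symbol_phiSeries_zero, zero_mul]
        | succ s =>
          rw [symbol_hansenSeries_succ_zero (symbol_ricciSeries_of_lt D (by omega)), zero_mul]
      · refine isSymbolCombination_mul_ricciSeries hx' h0 fun _ => ?_
        exact (((isSymbolCombination_hansenSeries_phiSeries s x.1).mono (by omega)
          (by omega)).add ((isSymbolCombination_phiSeries le_rfl).smul _)).congr
            fun D => (sub_add_cancel _ _).symm
    · rw [symbol_hansenSeries_add_two, potentialCoeff, Finset.prod_range_succ, ← potentialCoeff]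
      push_cast
      module

/-- As for `φ`, except that the monopole `1` contributes `S_{q+1}` itself, with weight collected in
`ricciCoeff`. The valence is written `q + 1` so that `isSymbolCombination_phiMSeries` applies. -/
lemma isSymbolCombination_hansenSeries_phiMSeries : ∀ s q : ℕ,
    IsSymbolCombination (q - 1) q (q + 1) fun D =>
      symbol (hansenSeries D.ricciSeries D.phiMSeries s (q + 1))
        - potentialCoeff s (q + 1 : ℕ) • symbol (D.phiMSeries (q + 1))
        - ricciCoeff s (q + 1 : ℕ) • symbol (D.ricciSeries (q + 1))
  | 0, q => IsSymbolCombination.zero.congr fun D => by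
      simp [symbol_hansenSeries_zero, potentialCoeff, ricciCoeff]
  | 1, q => IsSymbolCombination.zero.congr fun D => by
      simp [symbol_hansenSeries_one, potentialCoeff, ricciCoeff]
  | s + 2, q => by
    refine IsSymbolCombination.congr (.sub
      ((isSymbolCombination_hansenSeries_phiMSeries (s + 1) q).smul
        (((q + 1 : ℕ) : ℝ) - (s + 1)))
      (.smul (1 / 2 * (s + 1) * (2 * (s + 1) - 1) : ℝ) (.sum (antidiagonal q)
        (F := fun x D => symbol (hansenSeries D.ricciSeries D.phiMSeries s (x.1 + 1))
          * symbol (D.ricciSeries x.2)) fun x hx => ?_))) fun D => ?_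
    · have hx' := mem_antidiagonal.1 hx
      refine isSymbolCombination_mul_ricciSeries (i := x.1 + 1) (q := q + 1) (by omega)
        (Nat.succ_pos _) fun _ => ?_
      exact ((((isSymbolCombination_hansenSeries_phiMSeries s x.1).mono (by omega)
        (by omega)).add ((isSymbolCombination_ricciSeries le_rfl).smul _)).add
          (((isSymbolCombination_phiMSeries x.1).mono (by omega) (by omega)).smul _)).congr
            fun D => by rw [sub_add_cancel, sub_add_cancel]
    · rw [symbol_hansenSeries_add_two, potentialCoeff, Finset.prod_range_succ, ← potentialCoeff,
        Finset.Nat.sum_antidiagonal_succ]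
      -- The product term with a valence-`0` factor was split off: for `s = 0` it is the monopole
      -- times the Ricci term, with weight `1/2`; for later steps it vanishes.
      cases s with
      | zero =>
        rw [symbol_hansenSeries_zero, symbol_phiMSeries_zero, one_mul]
        simp only [ricciCoeff, Finset.prod_range_zero]
        push_cast
        module
      | succ s =>
        rw [symbol_hansenSeries_succ_zero (symbol_ricciSeries_of_lt D (by omega)), zero_mul,
          zero_add, ricciCoeff, Finset.prod_range_succ, ← mul_assoc]
        simp only [ricciCoeff]
        push_cast
        module

/-! ### The multipoles in terms of the null data -/

lemma symbol_nuS_one (D : NullData) : symbol ((Theta D).nuS 1) = symbol (D.psi 1) := by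
  refine (symbol_hansenSeries_one D.ricciSeries D.phiSeries 1).trans ?_
  rw [symbol_phiSeries]
  simp

lemma Theta_nuS_one (D : NullData) : (Theta D).nuS 1 = D.psi 1 :=
  symbol_injOn ((Theta D).nuS_mem 1) (D.psi_mem 1) (symbol_nuS_one D)

lemma isSymCombination_nuS_sub (p : ℕ) :
    IsSymCombination (p - 2) (p - 1) p fun D => (Theta D).nuS p - D.psi p := by
  obtain ⟨f, hf, h⟩ := isSymbolCombination_hansenSeries_phiSeries p p
  convert hf using 1
  funext D
  refine symbol_injOn ((stf p).sub_mem ((Theta D).nuS_mem p) (D.psi_mem p)) (hf.mem_stf D) ?_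
  have hne : (p.factorial : ℝ) ≠ 0 := by positivity
  rw [← h D]
  dsimp only
  rw [symbol_phiSeries, potentialCoeff_self, smul_smul, mul_inv_cancel₀ hne, one_smul,
    map_sub]
  rfl

lemma Theta_nuS_two (D : NullData) : (Theta D).nuS 2 = D.psi 2 :=
  sub_eq_zero.1 ((isSymCombination_nuS_sub 2).eq_zero D)

lemma symbol_phiSeries_mul (D : NullData) (i j : ℕ) :
    symbol (D.phiSeries i) * symbol (D.phiSeries j)
      = ((i.factorial : ℝ)⁻¹ * (j.factorial : ℝ)⁻¹) • (symbol (D.psi i) * symbol (D.psi j)) := by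
  rw [symbol_phiSeries, symbol_phiSeries]
  exact smul_mul_smul_comm _ _ _ _

lemma symbol_phiMSeries_one (D : NullData) : symbol (D.phiMSeries 1) = 0 := by
  rw [phiMSeries_one, map_zero]

lemma symbol_phiMSeries_two (D : NullData) : symbol (D.phiMSeries 2)
    = -(1 / 2 : ℝ) • (symbol (D.psi 1) * symbol (D.psi 1)) := by
  rw [symbol_phiMSeries_succ D 1, symbol_symMul, Finset.Nat.sum_antidiagonal_eq_sum_range_succ_mk]
  simp [Finset.sum_range_succ, symbol_phiSeries, symbol_phiMSeries_one, D.psi_zero]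

lemma symbol_phiMSeries_three (D : NullData) : symbol (D.phiMSeries 3)
    = -(1 / 2 : ℝ) • (symbol (D.psi 1) * symbol (D.psi 2)) := by
  rw [symbol_phiMSeries_succ D 2, symbol_symMul,
    sum_antidiagonal_add_three (f := fun q => symbol (D.phiSeries q)) (symbol_phiSeries_zero D)]
  simp only [symbol_phiSeries_mul, Finset.sum_range_succ]
  simp [symbol_phiMSeries_one]
  module

lemma Theta_nuM_two (D : NullData) : (Theta D).nuM 2 = -((1 / 2 : ℝ) • D.Psi 2)
    - symProd rfl (D.psi 1) (D.psi 1) := by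
  refine symbol_injOn ((Theta D).nuM_mem 2) ((stf 2).sub_mem ((stf 2).neg_mem
    ((stf 2).smul_mem _ (D.Psi_mem 2))) (symProd_mem _ _ _)) ?_
  refine (symbol_hansenSeries_add_two _ _ 0 2).trans ?_
  rw [symbol_hansenSeries_one, symbol_phiMSeries_two,
    Finset.Nat.sum_antidiagonal_eq_sum_range_succ_mk, map_sub, map_neg, map_smul, symbol_symProd]
  simp only [Finset.sum_range_succ, symbol_hansenSeries_zero, symbol_ricciSeries,
    symbol_phiMSeries_one, symbol_phiMSeries_zero, D.Psi_zero, map_zero]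
  simp
  module

lemma Theta_nuM_three (D : NullData) : (Theta D).nuM 3 = -((1 / 2 : ℝ) • D.Psi 3)
    - (3 : ℝ) • symProd rfl (D.psi 1) (D.psi 2) := by
  refine symbol_injOn ((Theta D).nuM_mem 3) ((stf 3).sub_mem ((stf 3).neg_mem
    ((stf 3).smul_mem _ (D.Psi_mem 3))) ((stf 3).smul_mem _ (symProd_mem _ _ _))) ?_
  refine (symbol_hansenSeries_add_two _ _ 1 3).trans ?_
  rw [symbol_hansenSeries_add_two _ _ 0 3, zero_add, symbol_hansenSeries_one,
    symbol_phiMSeries_three, Finset.Nat.sum_antidiagonal_eq_sum_range_succ_mk,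
    Finset.Nat.sum_antidiagonal_eq_sum_range_succ_mk, map_sub, map_neg, map_smul, map_smul,
    symbol_symProd]
  simp only [Finset.sum_range_succ, symbol_hansenSeries_zero, symbol_hansenSeries_one,
    symbol_ricciSeries, symbol_phiMSeries_one, symbol_phiMSeries_zero, D.Psi_zero, D.Psi_one,
    map_zero]
  simp
  module

/-- The remainder `f^M` in the expression of the mass multipoles. -/
def massRemainder (p : ℕ) (D : NullData) : Tensor p :=
  if hp : 1 ≤ p then (Theta D).nuM p - (-((1 / 2 : ℝ) • D.Psi p)
    - (p : ℝ) • symProd (Nat.add_sub_cancel' hp) (D.psi 1) (D.psi (p - 1)))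
  else 0

lemma Theta_nuM_eq (D : NullData) {p : ℕ} (hp : 1 ≤ p) :
    (Theta D).nuM p = -((1 / 2 : ℝ) • D.Psi p)
      - (p : ℝ) • symProd (Nat.add_sub_cancel' hp) (D.psi 1) (D.psi (p - 1))
      + massRemainder p D := by
  rw [massRemainder, dif_pos hp, add_sub_cancel]

lemma massRemainder_three (D : NullData) : massRemainder 3 D = 0 := by
  rw [massRemainder, dif_pos (by omega), Theta_nuM_three]
  exact sub_self _

lemma isSymCombination_massRemainder (r : ℕ) :
    IsSymCombination (r + 1) (r + 2) (r + 3) (massRemainder (r + 3)) := by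
  obtain ⟨f, hf, h⟩ := ((isSymbolCombination_hansenSeries_phiMSeries (r + 3) (r + 2)).add
    (((isSymbolCombination_phiMSeries_add r).mono le_rfl (Nat.zero_le _)).smul
      ((r + 3).factorial : ℝ)))
  suffices hfun : massRemainder (r + 3) = f by rw [hfun]; exact hf
  funext D
  have hm : massRemainder (r + 3) D ∈ stf (r + 3) := by
    rw [massRemainder, dif_pos (by omega)]
    exact (stf _).sub_mem ((Theta D).nuM_mem _) ((stf _).sub_mem ((stf _).neg_mem
      ((stf _).smul_mem _ (D.Psi_mem _))) ((stf _).smul_mem _ (symProd_mem _ _ _)))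
  refine symbol_injOn hm (hf.mem_stf D) ?_
  rw [← h D]
  dsimp only
  rw [massRemainder, dif_pos (by omega), map_sub, map_sub, map_neg, map_smul, map_smul,
    symbol_symProd, symbol_phiSeries_mul, symbol_ricciSeries, potentialCoeff_self,
    ricciCoeff_self (r + 1), show (Theta D).nuM (r + 3)
      = hansenSeries D.ricciSeries D.phiMSeries (r + 3) (r + 3) from rfl]
  have e1 : r + 2 + 1 - 2 = r + 1 := rfl
  rw [show D.psi (r + 3 - 1) = D.psi (r + 2) from rfl]
  have f1 : (((r + 1).factorial : ℝ)) * ((r + 1).factorial : ℝ)⁻¹ = 1 :=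
    mul_inv_cancel₀ (by positivity)
  -- This quotient is the coefficient `p` of `ψ_1 ⊙ ψ_{p-1}`.
  have f2 : (((r + 3).factorial : ℝ)) * ((r + 2).factorial : ℝ)⁻¹ = (r + 3 : ℕ) := by
    rw [Nat.factorial_succ (r + 2), Nat.cast_mul, mul_assoc, mul_inv_cancel₀ (by positivity),
      mul_one]
  simp only [e1, smul_add, smul_smul, mul_assoc, f1, mul_one,
    Nat.factorial_one, Nat.cast_one, inv_one, one_mul, f2]
  module

/-! ### `Θ` is bijective -/

lemma Theta_nuM_add_congr {D D' : NullData} {p : ℕ} (hp : 2 ≤ p)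
    (h1 : ∀ q < p, D.psi q = D'.psi q) (h2 : ∀ q < p, D.Psi q = D'.Psi q) :
    (Theta D).nuM p + (1 / 2 : ℝ) • D.Psi p = (Theta D').nuM p + (1 / 2 : ℝ) • D'.Psi p := by
  obtain rfl | hp := hp.eq_or_lt
  · rw [Theta_nuM_two, Theta_nuM_two, h1 1 (by omega)]
    abel
  · obtain ⟨r, rfl⟩ : ∃ r, p = r + 3 := ⟨p - 3, by omega⟩
    have := (isSymCombination_massRemainder r).congr (fun q hq => h1 q (by omega))
      (fun q hq => h2 q (by omega))
    rw [Theta_nuM_eq D (by omega), Theta_nuM_eq D' (by omega), this, h1 1 (by omega),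
      h1 (r + 3 - 1) (by omega)]
    abel

/-- The remainder contains `Ψ_q` only for `q ≤ p - 1`, so `ψ_p` and `Ψ_p` can be solved for
independently at each valence. -/
lemma Theta_nuS_sub_congr {D D' : NullData} {p : ℕ} (hp : 1 ≤ p)
    (h1 : ∀ q < p, D.psi q = D'.psi q) (h2 : ∀ q < p, D.Psi q = D'.Psi q) :
    (Theta D).nuS p - D.psi p = (Theta D').nuS p - D'.psi p :=
  (isSymCombination_nuS_sub p).congr (fun q hq => h1 q (by omega)) fun q hq => h2 q (by omega)

lemma Theta_congr {D D' : NullData} {n : ℕ}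
    (h : ∀ p ≤ n, D.psi p = D'.psi p ∧ D.Psi p = D'.Psi p) :
    ∀ p ≤ n, (Theta D).nuM p = (Theta D').nuM p ∧ (Theta D).nuS p = (Theta D').nuS p := by
  intro p hp
  have h1 : ∀ q < p, D.psi q = D'.psi q := fun q hq => (h q (by omega)).1
  have h2 : ∀ q < p, D.Psi q = D'.Psi q := fun q hq => (h q (by omega)).2
  constructor
  · obtain rfl | rfl | hp2 : p = 0 ∨ p = 1 ∨ 2 ≤ p := by omega
    · rw [Multipoles.nuM_zero, Multipoles.nuM_zero]
    · rw [Multipoles.nuM_one, Multipoles.nuM_one]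
    · have := Theta_nuM_add_congr hp2 h1 h2
      rwa [(h p hp).2, add_left_inj] at this
  · obtain rfl | hp1 := Nat.eq_zero_or_pos p
    · rw [Multipoles.nuS_zero, Multipoles.nuS_zero]
    · have := Theta_nuS_sub_congr hp1 h1 h2
      rwa [(h p hp).1, sub_left_inj] at this

lemma nullData_congr {D D' : NullData} {n : ℕ}
    (h : ∀ p ≤ n, (Theta D).nuM p = (Theta D').nuM p ∧ (Theta D).nuS p = (Theta D').nuS p) :
    ∀ p ≤ n, D.psi p = D'.psi p ∧ D.Psi p = D'.Psi p := by
  intro p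
  induction p using Nat.strong_induction_on with
  | _ p ih =>
  intro hp
  have h1 : ∀ q < p, D.psi q = D'.psi q := fun q hq => (ih q hq (by omega)).1
  have h2 : ∀ q < p, D.Psi q = D'.Psi q := fun q hq => (ih q hq (by omega)).2
  constructor
  · obtain rfl | hp1 := Nat.eq_zero_or_pos p
    · rw [D.psi_zero, D'.psi_zero]
    · have := Theta_nuS_sub_congr hp1 h1 h2
      rwa [(h p hp).2, sub_right_inj] at this
  · obtain rfl | rfl | hp2 : p = 0 ∨ p = 1 ∨ 2 ≤ p := by omega
    · rw [D.Psi_zero, D'.Psi_zero]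
    · rw [D.Psi_one, D'.Psi_one]
    · have := Theta_nuM_add_congr hp2 h1 h2
      rw [(h p hp).1, add_right_inj] at this
      exact smul_right_injective _ (by norm_num : (1 / 2 : ℝ) ≠ 0) this

/-- Null data with prescribed tensors of one valence. -/
def NullData.replace (D : NullData) (p : ℕ) (x y : Tensor p) (hx : x ∈ stf p) (hy : y ∈ stf p)
    (hx0 : p = 0 → x = 0) (hy0 : p ≤ 1 → y = 0) : NullData where
  psi := Function.update D.psi p x
  Psi := Function.update D.Psi p y
  psi_mem q := by
    obtain rfl | hq := eq_or_ne q p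
    · rwa [Function.update_self]
    · rw [Function.update_of_ne hq]; exact D.psi_mem q
  Psi_mem q := by
    obtain rfl | hq := eq_or_ne q p
    · rwa [Function.update_self]
    · rw [Function.update_of_ne hq]; exact D.Psi_mem q
  psi_zero := by
    obtain rfl | hq := eq_or_ne 0 p
    · rw [Function.update_self, hx0 rfl]
    · rw [Function.update_of_ne hq, D.psi_zero]
  Psi_zero := by
    obtain rfl | hq := eq_or_ne 0 p
    · rw [Function.update_self, hy0 (by omega)]
    · rw [Function.update_of_ne hq, D.Psi_zero]
  Psi_one := by
    obtain rfl | hq := eq_or_ne 1 p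
    · rw [Function.update_self, hy0 le_rfl]
    · rw [Function.update_of_ne hq, D.Psi_one]

lemma exists_Theta_eq_upto (N : Multipoles) (n : ℕ) :
    ∃ D : NullData, ∀ p ≤ n, (Theta D).nuM p = N.nuM p ∧ (Theta D).nuS p = N.nuS p := by
  induction n with
  | zero =>
    refine ⟨⟨fun _ => 0, fun _ => 0, fun p => (stf p).zero_mem, fun p => (stf p).zero_mem,
      rfl, rfl, rfl⟩, fun p hp => ?_⟩
    obtain rfl := Nat.le_zero.1 hp
    exact ⟨(Multipoles.nuM_zero _).trans N.nuM_zero.symm,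
      (Multipoles.nuS_zero _).trans N.nuS_zero.symm⟩
  | succ n ih =>
    obtain ⟨D, hD⟩ := ih
    -- The errors in the multipoles are divided by the diagonal coefficients, `1` for `ψ` and `-1/2`
    -- for `Ψ`; the latter gives the factor `2` and the reversed sign.
    let D' := D.replace (n + 1) (D.psi (n + 1) + (N.nuS (n + 1) - (Theta D).nuS (n + 1)))
      (D.Psi (n + 1) + (2 : ℝ) • ((Theta D).nuM (n + 1) - N.nuM (n + 1)))
      ((stf _).add_mem (D.psi_mem _) ((stf _).sub_mem (N.nuS_mem _) (Multipoles.nuS_mem _ _)))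
      ((stf _).add_mem (D.Psi_mem _)
        ((stf _).smul_mem _ ((stf _).sub_mem (Multipoles.nuM_mem _ _) (N.nuM_mem _))))
      (fun h => absurd h (Nat.succ_ne_zero n))
      -- At valence `1` both mass dipoles vanish, so the correction keeps the entry `Ψ_1` equal to
      -- zero.
      (fun h => by
        obtain rfl : n = 0 := by omega
        simp [D.Psi_one, N.nuM_one, Multipoles.nuM_one])
    have hlow (q : ℕ) (hq : q ≤ n) : D'.psi q = D.psi q ∧ D'.Psi q = D.Psi q :=
      ⟨Function.update_of_ne (by omega) _ _, Function.update_of_ne (by omega) _ _⟩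
    have hpsi : D'.psi (n + 1) = D.psi (n + 1) + (N.nuS (n + 1) - (Theta D).nuS (n + 1)) :=
      Function.update_self _ _ _
    have hPsi : D'.Psi (n + 1)
        = D.Psi (n + 1) + (2 : ℝ) • ((Theta D).nuM (n + 1) - N.nuM (n + 1)) :=
      Function.update_self _ _ _
    have h1 : ∀ q < n + 1, D'.psi q = D.psi q := fun q hq => (hlow q (by omega)).1
    have h2 : ∀ q < n + 1, D'.Psi q = D.Psi q := fun q hq => (hlow q (by omega)).2
    refine ⟨D', fun p hp => ?_⟩
    obtain hp | rfl := Nat.le_succ_iff.1 hp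
    · have := Theta_congr hlow p hp
      exact ⟨this.1.trans (hD p hp).1, this.2.trans (hD p hp).2⟩
    constructor
    · obtain rfl | hn := Nat.eq_zero_or_pos n
      · exact (Multipoles.nuM_one _).trans N.nuM_one.symm
      · have := Theta_nuM_add_congr (by omega) h1 h2
        rw [← eq_sub_iff_add_eq, hPsi] at this
        rw [this]
        module
    · have := Theta_nuS_sub_congr (by omega) h1 h2
      rw [sub_eq_iff_eq_add, hpsi] at this
      rw [this]
      abel

theorem Theta_injective : Function.Injective Theta := fun D D' h =>
  NullData.ext (funext fun p => (nullData_congr (n := p) (fun _ _ => by rw [h]; exact ⟨rfl, rfl⟩)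
    p le_rfl).1) (funext fun p => (nullData_congr (n := p)
      (fun _ _ => by rw [h]; exact ⟨rfl, rfl⟩) p le_rfl).2)

/-- Solutions up to different orders agree where both are determined, by `nullData_congr`, so the
diagonal sequence of the truncated solutions solves all orders at once. -/
theorem Theta_surjective : Function.Surjective Theta := by
  intro N
  choose D hD using exists_Theta_eq_upto N
  have hst {q p : ℕ} (hqp : q ≤ p) : (D q).psi q = (D p).psi q ∧ (D q).Psi q = (D p).Psi q :=
    nullData_congr (n := q) (fun r hr => ⟨(hD q r hr).1.trans (hD p r (hr.trans hqp)).1.symm,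
      (hD q r hr).2.trans (hD p r (hr.trans hqp)).2.symm⟩) q le_rfl
  let E : NullData :=
    { psi := fun p => (D p).psi p
      Psi := fun p => (D p).Psi p
      psi_mem := fun p => (D p).psi_mem p
      Psi_mem := fun p => (D p).Psi_mem p
      psi_zero := (D 0).psi_zero
      Psi_zero := (D 0).Psi_zero
      Psi_one := (D 1).Psi_one }
  have hE (p : ℕ) := Theta_congr (D := E) (D' := D p) (n := p) (fun q hq => hst hq) p le_rfl
  exact ⟨E, Multipoles.ext (funext fun p => (hE p).1.trans (hD p p le_rfl).1)
    (funext fun p => (hE p).2.trans (hD p p le_rfl).2)⟩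

end Hansen

end

theorem mainTheorem4 :
    -- `Θ` is the relation between null data and Hansen's multipoles
    (∀ (F : Hansen.StationaryFields) (p : ℕ),
      (Hansen.Theta F.nullData).nuM p = F.hansenField F.phiM p 0 ∧
      (Hansen.Theta F.nullData).nuS p = F.hansenField F.phiS p 0) ∧
    -- the multipoles of lowest order
    (∀ D : Hansen.NullData,
      (Hansen.Theta D).nuM 1 = 0 ∧
      (Hansen.Theta D).nuM 2 = -((1 / 2 : ℝ) • D.Psi 2)
        - Hansen.symProd rfl (D.psi 1) (D.psi 1) ∧
      (Hansen.Theta D).nuM 3 = -((1 / 2 : ℝ) • D.Psi 3)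
        - (3 : ℝ) • Hansen.symProd rfl (D.psi 1) (D.psi 2) ∧
      (Hansen.Theta D).nuS 1 = D.psi 1 ∧
      (Hansen.Theta D).nuS 2 = D.psi 2) ∧
    -- the triangular structure
    (∃ fM fS : (p : ℕ) → Hansen.NullData → Hansen.Tensor p,
      (∀ p, 3 ≤ p → Hansen.IsSymCombination (p - 2) (p - 1) p (fM p)) ∧
      (∀ p, 2 ≤ p → Hansen.IsSymCombination (p - 2) p p (fS p)) ∧
      (∀ D, fM 3 D = 0) ∧ (∀ D, fS 2 D = 0) ∧
      (∀ (D : Hansen.NullData) (p : ℕ) (hp : 3 ≤ p),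
        (Hansen.Theta D).nuM p = -((1 / 2 : ℝ) • D.Psi p)
          - (p : ℝ) • Hansen.symProd (Nat.add_sub_cancel' (by omega : 1 ≤ p))
              (D.psi 1) (D.psi (p - 1))
          + fM p D) ∧
      (∀ (D : Hansen.NullData) (p : ℕ), 2 ≤ p →
        (Hansen.Theta D).nuS p = D.psi p + fS p D)) ∧
    -- `Θ` is bijective, and it can be inverted recursively, order by order
    Function.Bijective Hansen.Theta ∧
    (∀ (n : ℕ) (D D' : Hansen.NullData),
      (∀ p ≤ n, D.psi p = D'.psi p ∧ D.Psi p = D'.Psi p) ↔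
      (∀ p ≤ n, (Hansen.Theta D).nuM p = (Hansen.Theta D').nuM p ∧
        (Hansen.Theta D).nuS p = (Hansen.Theta D').nuS p)) := by
  refine ⟨fun F p => F.Theta_nullData p, fun D => ⟨Hansen.Multipoles.nuM_one _,
    Hansen.Theta_nuM_two D, Hansen.Theta_nuM_three D, Hansen.Theta_nuS_one D,
    Hansen.Theta_nuS_two D⟩, ⟨Hansen.massRemainder, fun p D => (Hansen.Theta D).nuS p - D.psi p,
    fun p hp => ?_, fun p hp => ?_, Hansen.massRemainder_three, fun D => ?_, fun D p hp => ?_,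
    fun D p _ => ?_⟩, ⟨Hansen.Theta_injective, Hansen.Theta_surjective⟩,
    fun n D D' => ⟨Hansen.Theta_congr, Hansen.nullData_congr⟩⟩
  · obtain ⟨r, rfl⟩ : ∃ r, p = r + 3 := ⟨p - 3, by omega⟩
    exact Hansen.isSymCombination_massRemainder r
  · exact (Hansen.isSymCombination_nuS_sub p).mono le_rfl (by omega)
  · exact sub_eq_zero.2 (Hansen.Theta_nuS_two D)
  · exact Hansen.Theta_nuM_eq D (by omega)
  · exact (add_sub_cancel _ _).symm
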